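/- Manifolds are smooth, finite-dimensional, without boundary, Hausdorff and second countable. Let $G\rightrightarrows M$ and $G'\rightrightarrows M'$ be Lie groupoids, with source and target $s,t$. An isomorphism $\alpha:\theta_1\cong\theta_2$ between maps of Lie groupoids $\theta_1,\theta_2:(G\rightrightarrows M)\to(G'\rightrightarrows M')$ is a smooth map $\alpha:M\to G'$ assigning to each $x\in M$ an arrow $\alpha(x):\theta_1(x)\to\theta_2(x)$ such that $\alpha(t(g))\,\theta_1(g)=\theta_2(g)\,\alpha(s(g))$ for all $g\in G$. A map of Lie groupoids $\phi:(H\rightrightarrows N)\to(G\rightrightarrows M)$ is a *weak equivalence* if the square formed by $\phi:H\to G$, $\phi\times\phi:N\times N\to M\times M$ and the anchors $(t,s)$ is a good pullback of manifolds (a pullback of manifolds which is also a pullback of topological spaces and induces pullbacks of tangent spaces), and the map $G\times_MN=\{(g,n): s(g)=\phi(n)\}\to M$, $(g,n)\mapsto t(g)$, is a surjective submersion. A *generalized map* $G\dashrightarrow G'$, or map of orbispaces $[M/G]\to[M'/G']$, is a class of fractions $\psi/\phi$, $G\xleftarrow{\ \phi\ }H\xrightarrow{\ \psi\ }G'$ with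 $\phi$ a weak equivalence; $\psi_1/\phi_1=\psi_2/\phi_2$ if there are a fraction $\psi_3/\phi_3$ with middle term $H_3$ and maps $h_i:H_3\to H_i$ with $\phi_ih_i\cong\phi_3$ and $\psi_ih_i\cong\psi_3$ for $i=1,2$. The composite of $\psi/\phi:G\dashrightarrow G'$, with middle term $H$, followed by $\psi'/\phi':G'\dashrightarrow G''$, with middle term $H'$, is $(\psi'\lambda)/(\phi\kappa)$ for any $\kappa:K\to H$, $\lambda:K\to H'$ with $\kappa$ a weak equivalence and $\psi\kappa\cong\phi'\lambda$. A map $\theta$ of Lie groupoids is regarded as the generalized map $\theta/1$, and a manifold $M$ as the unit groupoid $M\rightrightarrows M$. The *presentation* $\pi:M\to[M/G]$ is given by the inclusion $(M\rightrightarrows M)\to(G\rightrightarrows M)$; write $\pi':M'\to[M'/G']$ for the one of $G'$. A *commutative square* between the presentations is a pair $(f,F)$ of a smooth map $f:M\to M'$ and a map of orbispaces $F:[M/G]\to[M'/G']$ such that $\pi' f=F\pi$ as maps of orbispaces. Two squares $(f_1,F_1)$, $(f_2,F_2)$ are *isomorphic* if $F_1=F_2$ and $\pi'f_1\cong\pi'f_2$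 as maps of Lie groupoids $(M\rightrightarrows M)\to(G'\rightrightarrows M')$, i.e. there is a smooth $\alpha:M\to G'$ with $\alpha(x):f_1(x)\to f_2(x)$ for all $x\in M$. **Theorem.** Every map of Lie groupoids $\theta:(G\rightrightarrows M)\to(G'\rightrightarrows M')$ induces a commutative square $(\theta|_M,\ \theta/1)$, and this assignment induces 1. a bijection between isomorphism classes of maps $(G\rightrightarrows M)\to(G'\rightrightarrows M')$ and isomorphism classes of commutative squares between the presentations $\pi$ and $\pi'$; 2. a bijection between maps $(G\rightrightarrows M)\to(G'\rightrightarrows M')$ modulo the relation "$\theta_1\cong\theta_2$ and $\theta_1|_M=\theta_2|_M$" and commutative squares $(f,F)$ between the presentations $\pi$ and $\pi'$. In particular every commutative square is induced by a map of Lie groupoids. -/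

import Mathlib

open scoped Manifold ContDiff Topology

universe u

noncomputable section

namespace LieGpd

/-- A smooth manifold: finite-dimensional, without boundary, Hausdorff and second countable
(possibly empty, possibly disconnected). -/
structure Mfd : Type (u + 1) where
  carrier : Type u
  dim : ℕ
  [top : TopologicalSpace carrier]
  [charted : ChartedSpace (EuclideanSpace ℝ (Fin dim)) carrier]
  [smooth : IsManifold (𝓡 dim) ∞ carrier]
  [t2 : T2Space carrier]
  [secondCountable : SecondCountableTopology carrier]

instance : CoeSort Mfd.{u} (Type u) := ⟨Mfd.carrier⟩

attribute [instance] Mfd.top Mfd.charted Mfd.smooth Mfd.t2 Mfd.secondCountable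

/-- Smooth maps between manifolds. -/
abbrev Smooth {M N : Mfd.{u}} (f : M → N) : Prop :=
  ContMDiff (𝓡 M.dim) (𝓡 N.dim) ∞ f

/-- The differential of a map at a point. -/
abbrev tangent {M N : Mfd.{u}} (f : M → N) (x : M) :
    TangentSpace (𝓡 M.dim) x →L[ℝ] TangentSpace (𝓡 N.dim) (f x) :=
  mfderiv (𝓡 M.dim) (𝓡 N.dim) f x

/-- A submersion: a smooth map all of whose differentials are surjective. -/
structure IsSubmersion {M N : Mfd.{u}} (f : M → N) : Prop where
  smooth : Smooth f
  surjective : ∀ x, Function.Surjective (tangent f x)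

/-- The commutative square of smooth maps
```
  P --q--> M₂
  |p       |f₂
  M₁ -f₁-> M
```
is a good pullback: it is a pullback in the category of manifolds (`lift`; uniqueness of the lift
follows from `embedding`), a pullback of topological spaces (`embedding`, `exists_point`),
and `0 → T P → T M₁ × T M₂ → T M` is exact (`tangent_injective`, `tangent_exact`). -/
structure IsGoodPullback
    {E₁ H₁ : Type*} [NormedAddCommGroup E₁] [NormedSpace ℝ E₁] [TopologicalSpace H₁]
    {E₂ H₂ : Type*} [NormedAddCommGroup E₂] [NormedSpace ℝ E₂] [TopologicalSpace H₂]
    {E₃ H₃ : Type*} [NormedAddCommGroup E₃] [NormedSpace ℝ E₃] [TopologicalSpace H₃]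
    {E₄ H₄ : Type*} [NormedAddCommGroup E₄] [NormedSpace ℝ E₄] [TopologicalSpace H₄]
    (IP : ModelWithCorners ℝ E₁ H₁) (I₁ : ModelWithCorners ℝ E₂ H₂)
    (I₂ : ModelWithCorners ℝ E₃ H₃) (I : ModelWithCorners ℝ E₄ H₄)
    {P M₁ M₂ M : Type u}
    [TopologicalSpace P] [ChartedSpace H₁ P] [TopologicalSpace M₁] [ChartedSpace H₂ M₁]
    [TopologicalSpace M₂] [ChartedSpace H₃ M₂] [TopologicalSpace M] [ChartedSpace H₄ M]
    (p : P → M₁) (q : P → M₂) (f₁ : M₁ → M) (f₂ : M₂ → M) : Prop where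
  comm : ∀ z, f₁ (p z) = f₂ (q z)
  lift : ∀ (X : Mfd.{u}) (a : X → M₁) (b : X → M₂), ContMDiff (𝓡 X.dim) I₁ ∞ a →
    ContMDiff (𝓡 X.dim) I₂ ∞ b → (∀ x, f₁ (a x) = f₂ (b x)) →
    ∃ c : X → P, ContMDiff (𝓡 X.dim) IP ∞ c ∧ (∀ x, p (c x) = a x) ∧ ∀ x, q (c x) = b x
  embedding : Topology.IsEmbedding fun z => (p z, q z)
  exists_point : ∀ a b, f₁ a = f₂ b → ∃ z, p z = a ∧ q z = b
  tangent_injective : ∀ z (v : TangentSpace IP z),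
    mfderiv IP I₁ p z v = 0 → mfderiv IP I₂ q z v = 0 → v = 0
  tangent_exact : ∀ z (v : TangentSpace I₁ (p z)) (w : TangentSpace I₂ (q z)),
    (mfderiv I₁ I f₁ (p z) v : E₄) = (mfderiv I₂ I f₂ (q z) w : E₄) →
    ∃ r : TangentSpace IP z, mfderiv IP I₁ p z r = v ∧ mfderiv IP I₂ q z r = w

end LieGpd

open LieGpd

/-- A Lie groupoid `G ⇉ M`. Arrows `g` go from `s g` to `t g`, and `mul g h` is the composite
`g h` of two arrows with `s g = t h`; on other pairs `mul` is irrelevant. Multiplication is smooth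
on the submanifold of composable pairs. -/
structure LieGroupoid : Type (u + 1) where
  /-- the manifold `M` of objects -/
  Ob : Mfd.{u}
  /-- the manifold `G` of arrows -/
  Ar : Mfd.{u}
  s : Ar → Ob
  t : Ar → Ob
  mul : Ar → Ar → Ar
  unit : Ob → Ar
  inv : Ar → Ar
  s_submersion : IsSubmersion s
  t_submersion : IsSubmersion t
  mul_smooth : ContMDiffOn ((𝓡 Ar.dim).prod (𝓡 Ar.dim)) (𝓡 Ar.dim) ∞
    (fun p : Ar × Ar => mul p.1 p.2) {p | s p.1 = t p.2}
  unit_smooth : Smooth unit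
  inv_smooth : Smooth inv
  s_mul : ∀ g h, s g = t h → s (mul g h) = s h
  t_mul : ∀ g h, s g = t h → t (mul g h) = t g
  mul_assoc : ∀ g h k, s g = t h → s h = t k → mul (mul g h) k = mul g (mul h k)
  s_unit : ∀ x, s (unit x) = x
  t_unit : ∀ x, t (unit x) = x
  mul_unit : ∀ g, mul g (unit (s g)) = g
  unit_mul : ∀ g, mul (unit (t g)) g = g
  s_inv : ∀ g, s (inv g) = t g
  t_inv : ∀ g, t (inv g) = s g
  mul_inv : ∀ g, mul g (inv g) = unit (t g)
  inv_mul : ∀ g, mul (inv g) g = unit (s g)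

namespace LieGroupoid

/-- The anchor `ρ = (t, s) : G → M × M`. -/
def anchor (G : LieGroupoid.{u}) (g : G.Ar) : G.Ob × G.Ob := (G.t g, G.s g)

/-- Maps of Lie groupoids. They automatically commute with units and inverses. -/
@[ext]
structure Hom (G G' : LieGroupoid.{u}) where
  ob : G.Ob → G'.Ob
  ar : G.Ar → G'.Ar
  ob_smooth : Smooth ob
  ar_smooth : Smooth ar
  s_ar : ∀ g, G'.s (ar g) = ob (G.s g)
  t_ar : ∀ g, G'.t (ar g) = ob (G.t g)
  ar_mul : ∀ g h, G.s g = G.t h → ar (G.mul g h) = G'.mul (ar g) (ar h)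

lemma eq_unit_of_mul_self (G : LieGroupoid.{u}) (g : G.Ar) (h : G.s g = G.t g)
    (hg : G.mul g g = g) : g = G.unit (G.s g) := by
  have h1 := G.mul_assoc (G.inv g) g g (G.s_inv g) h
  rw [G.inv_mul, hg, G.inv_mul, h, G.unit_mul] at h1
  rw [h]; exact h1

lemma Hom.ar_unit {G G' : LieGroupoid.{u}} (φ : Hom G G') (x : G.Ob) :
    φ.ar (G.unit x) = G'.unit (φ.ob x) := by
  have h := G'.eq_unit_of_mul_self (φ.ar (G.unit x))
    (by rw [φ.s_ar, φ.t_ar, G.s_unit, G.t_unit])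
    (by
      rw [← φ.ar_mul _ _ (by rw [G.s_unit, G.t_unit])]
      have := G.mul_unit (G.unit x)
      rw [G.s_unit] at this
      rw [this])
  rwa [φ.s_ar, G.s_unit] at h

/-- The identity map. -/
def Hom.id (G : LieGroupoid.{u}) : Hom G G where
  ob := fun x => x
  ar := fun g => g
  ob_smooth := contMDiff_id
  ar_smooth := contMDiff_id
  s_ar _ := rfl
  t_ar _ := rfl
  ar_mul _ _ _ := rfl

/-- Composition of maps, `ψ.comp φ = ψ φ`. -/
def Hom.comp {G G' G'' : LieGroupoid.{u}} (ψ : Hom G' G'') (φ : Hom G G') : Hom G G'' where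
  ob := fun x => ψ.ob (φ.ob x)
  ar := fun g => ψ.ar (φ.ar g)
  ob_smooth := ψ.ob_smooth.comp φ.ob_smooth
  ar_smooth := ψ.ar_smooth.comp φ.ar_smooth
  s_ar g := by rw [ψ.s_ar, φ.s_ar]
  t_ar g := by rw [ψ.t_ar, φ.t_ar]
  ar_mul g h hgh := by
    rw [φ.ar_mul g h hgh, ψ.ar_mul]
    rw [φ.s_ar, φ.t_ar, hgh]

/-- `α` is an isomorphism `φ₁ ≅ φ₂` of maps `G → G'`: it assigns to `x` an arrow
`α x : φ₁ x → φ₂ x`, smoothly and naturally. -/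
structure IsHomIso {G G' : LieGroupoid.{u}} (φ₁ φ₂ : Hom G G') (α : G.Ob → G'.Ar) : Prop where
  smooth : Smooth α
  s_eq : ∀ x, G'.s (α x) = φ₁.ob x
  t_eq : ∀ x, G'.t (α x) = φ₂.ob x
  naturality : ∀ g, G'.mul (α (G.t g)) (φ₁.ar g) = G'.mul (φ₂.ar g) (α (G.s g))

/-- Two maps of Lie groupoids are isomorphic. -/
def Isomorphic {G G' : LieGroupoid.{u}} (φ₁ φ₂ : Hom G G') : Prop :=
  ∃ α, IsHomIso φ₁ φ₂ α

lemma Isomorphic.refl {G G' : LieGroupoid.{u}} (φ : Hom G G') : Isomorphic φ φ := by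
  refine ⟨fun x => G'.unit (φ.ob x), G'.unit_smooth.comp φ.ob_smooth, fun x => G'.s_unit _,
    fun x => G'.t_unit _, fun g => ?_⟩
  rw [← φ.t_ar, G'.unit_mul, ← φ.s_ar, G'.mul_unit]

lemma Isomorphic.symm {G G' : LieGroupoid.{u}} {φ₁ φ₂ : Hom G G'} (h : Isomorphic φ₁ φ₂) :
    Isomorphic φ₂ φ₁ := by
  obtain ⟨α, hs, h1, h2, h3⟩ := h
  refine ⟨fun x => G'.inv (α x), G'.inv_smooth.comp hs, fun x => by rw [G'.s_inv, h2],
    fun x => by rw [G'.t_inv, h1], fun g => ?_⟩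
  have a1 : G'.s (G'.inv (α (G.t g))) = G'.t (φ₂.ar g) := by rw [G'.s_inv, h2, φ₂.t_ar]
  have a2 : G'.s (φ₂.ar g) = G'.t (α (G.s g)) := by rw [h2, φ₂.s_ar]
  have a3 : G'.s (α (G.t g)) = G'.t (φ₁.ar g) := by rw [h1, φ₁.t_ar]
  have a4 : G'.s (α (G.s g)) = G'.t (G'.inv (α (G.s g))) := by rw [G'.t_inv]
  calc G'.mul (G'.inv (α (G.t g))) (φ₂.ar g)
      = G'.mul (G'.mul (G'.inv (α (G.t g))) (φ₂.ar g))
          (G'.mul (α (G.s g)) (G'.inv (α (G.s g)))) := by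
        rw [G'.mul_inv, ← a2, ← G'.s_mul _ _ a1, G'.mul_unit]
    _ = G'.mul (G'.mul (G'.mul (G'.inv (α (G.t g))) (φ₂.ar g)) (α (G.s g)))
          (G'.inv (α (G.s g))) := by
        rw [G'.mul_assoc _ (α (G.s g)) _ (by rw [G'.s_mul _ _ a1, a2]) a4]
    _ = G'.mul (G'.mul (G'.mul (G'.inv (α (G.t g))) (α (G.t g))) (φ₁.ar g))
          (G'.inv (α (G.s g))) := by
        rw [G'.mul_assoc _ (φ₂.ar g) _ a1 a2, ← h3, G'.mul_assoc _ _ _ (G'.s_inv _) a3]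
    _ = G'.mul (φ₁.ar g) (G'.inv (α (G.s g))) := by
        rw [G'.inv_mul, a3, G'.unit_mul]

lemma Isomorphic.trans {G G' : LieGroupoid.{u}} {φ₁ φ₂ φ₃ : Hom G G'} (h : Isomorphic φ₁ φ₂)
    (h' : Isomorphic φ₂ φ₃) : Isomorphic φ₁ φ₃ := by
  obtain ⟨α, hs, h1, h2, h3⟩ := h
  obtain ⟨β, ks, k1, k2, k3⟩ := h'
  have hc : ∀ x, G'.s (β x) = G'.t (α x) := fun x => by rw [k1, h2]
  refine ⟨fun x => G'.mul (β x) (α x), ?_, fun x => by rw [G'.s_mul _ _ (hc x), h1],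
    fun x => by rw [G'.t_mul _ _ (hc x), k2], fun g => ?_⟩
  · exact G'.mul_smooth.comp_contMDiff (ks.prodMk hs) hc
  · rw [G'.mul_assoc _ _ _ (hc _) (by rw [h1, φ₁.t_ar]), h3,
      ← G'.mul_assoc _ _ _ (by rw [k1, φ₂.t_ar]) (by rw [h2, φ₂.s_ar]), k3,
      G'.mul_assoc _ _ _ (by rw [k2, φ₃.s_ar]) (hc _)]

/-- The setoid of isomorphic maps; its quotient is `Maps(G, G')/≅`. -/
def isoSetoid (G G' : LieGroupoid.{u}) : Setoid (Hom G G') where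
  r := Isomorphic
  iseqv := ⟨Isomorphic.refl, Isomorphic.symm, Isomorphic.trans⟩

/-- The finer setoid of maps which are isomorphic and have the same underlying map on objects. -/
def isoOverBaseSetoid (G G' : LieGroupoid.{u}) : Setoid (Hom G G') where
  r θ₁ θ₂ := θ₁.ob = θ₂.ob ∧ Isomorphic θ₁ θ₂
  iseqv := ⟨fun θ => ⟨rfl, .refl θ⟩, fun h => ⟨h.1.symm, h.2.symm⟩,
    fun h h' => ⟨h.1.trans h'.1, h.2.trans h'.2⟩⟩

/-- `φ` is fully faithful: the square formed by `φ`, `φ × φ` and the two anchors is a good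
pullback. -/
def FullyFaithful {G G' : LieGroupoid.{u}} (φ : Hom G G') : Prop :=
  IsGoodPullback (𝓡 G.Ar.dim) ((𝓡 G.Ob.dim).prod (𝓡 G.Ob.dim)) (𝓡 G'.Ar.dim)
    ((𝓡 G'.Ob.dim).prod (𝓡 G'.Ob.dim)) G.anchor φ.ar (Prod.map φ.ob φ.ob) G'.anchor

/-- `φ` is essentially surjective: the map `G' ×_{M'} M → M'`, `(g', x) ↦ t g'`, is a surjective
submersion. Here `G' ×_{M'} M = {(g', x) | s g' = φ x}` is a good pullback, so that its tangent
space at `(g', x)` consists of the pairs `(v, w)` with `ds v = dφ w`. -/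
structure EssentiallySurjective {G G' : LieGroupoid.{u}} (φ : Hom G G') : Prop where
  surjective : ∀ y : G'.Ob, ∃ (g : G'.Ar) (x : G.Ob), G'.s g = φ.ob x ∧ G'.t g = y
  submersion : ∀ (g : G'.Ar) (x : G.Ob), G'.s g = φ.ob x →
    ∀ a : TangentSpace (𝓡 G'.Ob.dim) (G'.t g),
      ∃ (v : TangentSpace (𝓡 G'.Ar.dim) g) (w : TangentSpace (𝓡 G.Ob.dim) x),
        (tangent G'.s g v : EuclideanSpace ℝ (Fin G'.Ob.dim)) = tangent φ.ob x w ∧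
          tangent G'.t g v = a

/-- Weak equivalences of Lie groupoids. -/
structure IsWeakEquivalence {G G' : LieGroupoid.{u}} (φ : Hom G G') : Prop where
  fullyFaithful : FullyFaithful φ
  essentiallySurjective : EssentiallySurjective φ

lemma isWeakEquivalence_id (G : LieGroupoid.{u}) : IsWeakEquivalence (Hom.id G) := by
  have hs : MDifferentiable (𝓡 G.Ar.dim) (𝓡 G.Ob.dim) G.s :=
    G.s_submersion.smooth.mdifferentiable (by simp)
  have ht : MDifferentiable (𝓡 G.Ar.dim) (𝓡 G.Ob.dim) G.t :=
    G.t_submersion.smooth.mdifferentiable (by simp)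
  have hc : Continuous G.anchor :=
    G.t_submersion.smooth.continuous.prodMk G.s_submersion.smooth.continuous
  refine ⟨⟨fun _ => rfl, ?_, ?_, ?_, ?_, ?_⟩, ⟨?_, ?_⟩⟩
  · intro X a b _ hb hab
    exact ⟨b, hb, fun x => (hab x).symm, fun x => rfl⟩
  · exact Topology.IsEmbedding.of_leftInverse (f := Prod.snd) (fun _ => rfl) continuous_snd
      (hc.prodMk continuous_id)
  · intro a b hab
    exact ⟨b, hab.symm, rfl⟩
  · intro z v _ hv
    have h : mfderiv (𝓡 G.Ar.dim) (𝓡 G.Ar.dim) (fun g : G.Ar => g) z v = v := by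
      rw [show (fun g : G.Ar => g) = id from rfl, mfderiv_id]; rfl
    exact h.symm.trans hv
  · intro z v w hvw
    refine ⟨w, ?_, ?_⟩
    · refine Eq.trans hvw.symm ?_
      rw [show Prod.map (Hom.id G).ob (Hom.id G).ob = id from rfl, mfderiv_id]; rfl
    · rw [show (Hom.id G).ar = id from rfl, mfderiv_id]; rfl
  · intro y
    exact ⟨G.unit y, y, G.s_unit y, G.t_unit y⟩
  · intro g x hgx a
    obtain ⟨v, hv⟩ := G.t_submersion.surjective g a
    refine ⟨v, tangent G.s g v, ?_, hv⟩
    unfold tangent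
    rw [show (Hom.id G).ob = id from rfl, mfderiv_id]; rfl

/-- A fraction `ψ/φ` from `G` to `G'`: maps `G ←φ— H —ψ→ G'` with `φ` a weak equivalence. -/
structure Fraction (G G' : LieGroupoid.{u}) where
  H : LieGroupoid.{u}
  φ : Hom H G
  ψ : Hom H G'
  weq : IsWeakEquivalence φ

/-- Two fractions present the same generalized map if a third fraction fits with them into a
diagram which commutes up to isomorphisms. -/
def FractionRel {G G' : LieGroupoid.{u}} (a b : Fraction G G') : Prop :=
  ∃ (c : Fraction G G') (h : Hom c.H a.H) (k : Hom c.H b.H),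
    Isomorphic (a.φ.comp h) c.φ ∧ Isomorphic (a.ψ.comp h) c.ψ ∧
    Isomorphic (b.φ.comp k) c.φ ∧ Isomorphic (b.ψ.comp k) c.ψ

/-- Generalized maps `G ⇢ G'`, that is, maps of orbispaces `[M/G] → [M'/G']`: fractions modulo
`FractionRel` (an equivalence relation, as homotopy pullbacks show; `Quot` does not need this). -/
def GenMap (G G' : LieGroupoid.{u}) : Type (u + 1) := Quot (FractionRel (G := G) (G' := G'))

/-- The generalized map presented by a fraction. -/
def Fraction.toGenMap {G G' : LieGroupoid.{u}} (a : Fraction G G') : GenMap G G' := Quot.mk _ a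

/-- The generalized map `φ/1` given by a map of Lie groupoids. -/
def Hom.toGenMap {G G' : LieGroupoid.{u}} (φ : Hom G G') : GenMap G G' :=
  Fraction.toGenMap ⟨G, Hom.id G, φ, isWeakEquivalence_id G⟩

/-- `E : G ⇢ G''` is the composite of `F : G ⇢ G'` followed by `F' : G' ⇢ G''`: for fractions
`ψ/φ` of `F` and `ψ'/φ'` of `F'`, and a square `ψ κ ≅ φ' lam` with `κ : K → H` a weak equivalence
and `lam : K → H'`, it is the class of `ψ' lam / φ κ`. -/
def IsComposite {G G' G'' : LieGroupoid.{u}} (F : GenMap G G') (F' : GenMap G' G'')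
    (E : GenMap G G'') : Prop :=
  ∃ (a : Fraction G G') (a' : Fraction G' G'') (K : LieGroupoid.{u})
    (κ : Hom K a.H) (lam : Hom K a'.H) (_ : IsWeakEquivalence κ)
    (hw : IsWeakEquivalence (a.φ.comp κ)),
    Isomorphic (a.ψ.comp κ) (a'.φ.comp lam) ∧ a.toGenMap = F ∧ a'.toGenMap = F' ∧
      Fraction.toGenMap ⟨K, a.φ.comp κ, a'.ψ.comp lam, hw⟩ = E

/-- The unit groupoid `M ⇉ M` of a manifold. -/
def ofMfd (M : Mfd.{u}) : LieGroupoid.{u} where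
  Ob := M
  Ar := M
  s := fun x => x
  t := fun x => x
  mul := fun x _ => x
  unit := fun x => x
  inv := fun x => x
  s_submersion := ⟨contMDiff_id, fun x v => ⟨v, by
    unfold tangent; rw [show (fun x : M => x) = _root_.id from rfl, mfderiv_id]; rfl⟩⟩
  t_submersion := ⟨contMDiff_id, fun x v => ⟨v, by
    unfold tangent; rw [show (fun x : M => x) = _root_.id from rfl, mfderiv_id]; rfl⟩⟩
  mul_smooth := contMDiff_fst.contMDiffOn
  unit_smooth := contMDiff_id
  inv_smooth := contMDiff_id
  s_mul _ _ h := h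
  t_mul _ _ _ := rfl
  mul_assoc _ _ _ _ _ := rfl
  s_unit _ := rfl
  t_unit _ := rfl
  mul_unit _ := rfl
  unit_mul _ := rfl
  s_inv _ := rfl
  t_inv _ := rfl
  mul_inv _ := rfl
  inv_mul _ := rfl

/-- A smooth map of manifolds, as a map of unit groupoids. -/
def homOfSmooth {M M' : Mfd.{u}} (f : M → M') (hf : Smooth f) : Hom (ofMfd M) (ofMfd M') where
  ob := f
  ar := f
  ob_smooth := hf
  ar_smooth := hf
  s_ar _ := rfl
  t_ar _ := rfl
  ar_mul _ _ _ := rfl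

/-- The inclusion `(M ⇉ M) → (G ⇉ M)`; as a map of orbispaces it is the presentation
`M → [M/G]`. -/
def presentation (G : LieGroupoid.{u}) : Hom (ofMfd G.Ob) G where
  ob := fun x => x
  ar := G.unit
  ob_smooth := contMDiff_id
  ar_smooth := G.unit_smooth
  s_ar := G.s_unit
  t_ar := G.t_unit
  ar_mul x y h := by
    obtain rfl : x = y := h
    refine (Eq.symm ?_ : G.unit x = G.mul (G.unit x) (G.unit x))
    calc G.mul (G.unit x) (G.unit x)
        = G.mul (G.unit x) (G.unit (G.s (G.unit x))) := by
          rw [show G.s (G.unit x) = x from G.s_unit x]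
      _ = G.unit x := G.mul_unit (G.unit x)

/-- Commutative squares of orbispaces between the presentations `π : M → [M/G]` and
`π' : M' → [M'/G']`: a smooth map `f : M → M'` and a map of orbispaces `F : [M/G] → [M'/G']`
such that `π' f = F π`. -/
@[ext]
structure CommSquare (G G' : LieGroupoid.{u}) where
  f : G.Ob → G'.Ob
  f_smooth : Smooth f
  F : GenMap G G'
  comm : ∃ E : GenMap (ofMfd G.Ob) G',
    IsComposite (homOfSmooth f f_smooth).toGenMap G'.presentation.toGenMap E ∧
      IsComposite G.presentation.toGenMap F E

/-- The setoid of isomorphic squares: the two squares have the same map of orbispaces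
`[M/G] → [M'/G']`, and their maps `f₁, f₂ : M → M'` become isomorphic as maps from `M ⇉ M` to
`G' ⇉ M'`, that is, there is a smooth `α : M → G'` with `α x : f₁ x → f₂ x` for all `x`. -/
def squareSetoid (G G' : LieGroupoid.{u}) : Setoid (CommSquare G G') where
  r S₁ S₂ := S₁.F = S₂.F ∧
    Isomorphic (G'.presentation.comp (homOfSmooth S₁.f S₁.f_smooth))
      (G'.presentation.comp (homOfSmooth S₂.f S₂.f_smooth))
  iseqv := ⟨fun _ => ⟨rfl, .refl _⟩, fun h => ⟨h.1.symm, h.2.symm⟩,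
    fun h h' => ⟨h.1.trans h'.1, h.2.trans h'.2⟩⟩

lemma isComposite_toGenMap {G G' G'' : LieGroupoid.{u}} (φ : Hom G G') (ψ : Hom G' G'') :
    IsComposite φ.toGenMap ψ.toGenMap (ψ.comp φ).toGenMap :=
  ⟨⟨G, Hom.id G, φ, isWeakEquivalence_id G⟩, ⟨G', Hom.id G', ψ, isWeakEquivalence_id G'⟩, G,
    Hom.id G, φ, isWeakEquivalence_id G, isWeakEquivalence_id G, .refl φ, rfl, rfl, rfl⟩

/-- The commutative square induced by a map of Lie groupoids `θ`: it consists of the map on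
objects `θ : M → M'` and the generalized map `θ/1`. -/
def Hom.square {G G' : LieGroupoid.{u}} (θ : Hom G G') : CommSquare G G' where
  f := θ.ob
  f_smooth := θ.ob_smooth
  F := θ.toGenMap
  comm := by
    refine ⟨_, isComposite_toGenMap _ _, ?_⟩
    have h : G'.presentation.comp (homOfSmooth θ.ob θ.ob_smooth) = θ.comp G.presentation := by
      ext x
      · rfl
      · exact (θ.ar_unit x).symm
    rw [h]
    exact isComposite_toGenMap _ _

end LieGroupoid

end

open LieGpd

/-! ### Groupoid algebra and whiskering -/

namespace LieGroupoid

/-! Two facts carry the theorem: a fraction `ψ/φ` equals `θ/1` exactly when `ψ ≅ θφ`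
(`Fraction.toGenMap_eq_iff`), and every square comes, on the nose, from a map of groupoids
(`Hom.square_surjective`).

For the first, the condition `ψ ≅ θφ` does not change when the fraction is refined along some `h`
with `φh ≅ φ₃` and `ψh ≅ ψ₃`. One direction is whiskering. For the other, `h` inherits from `φ` and
`φ₃` fullness and local sections up to arrows, and isomorphisms descend along such maps
(`isomorphic_of_comp`). So the condition depends only on the generalized map. With `φ = 1` it says
that `θ₁/1 = θ₂/1` exactly when `θ₁ ≅ θ₂`, which gives injectivity in both parts.

For the second, let `F = ψ/φ` with middle term `H`. By the first fact the equation `π'f = Fπ`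
becomes concrete data: a weak equivalence `w : K → M`, a map `l : K → H`, and isomorphisms `β : φl ≅
πw` and `γ : ψl ≅ π'fw`. For an arrow `g` of `G` and points `p`, `q` of `K` over its source and
target, `β(q)⁻¹ g β(p)` is `φ(h)` for a unique `h : l(p) → l(q)`, and `θ(g) = γ(q) ψ(h) γ(p)⁻¹` is
forced. Points in one fibre of `w` are joined by arrows of `K`, so the choices do not matter; the
same argument produces `ψ ≅ θφ`. By construction `θ` is `f` on objects.

Smoothness is always obtained in one way: the value is characterized by a relation with at most one
solution that has smooth solutions locally (`exists_smooth_of_local`). The local solutions come from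
the lifting property of good pullbacks and from local sections of essentially surjective maps, the
latter a consequence of the inverse function theorem. -/

lemma mul_inv_mul (G : LieGroupoid.{u}) {e x : G.Ar} (h : G.t e = G.t x) :
    G.mul e (G.mul (G.inv e) x) = x := by
  rw [← G.mul_assoc _ _ _ (G.t_inv e).symm (by rw [G.s_inv, h]), G.mul_inv, h, G.unit_mul]

lemma mul_inv_mul_right (G : LieGroupoid.{u}) {e x : G.Ar} (h : G.s x = G.s e) :
    G.mul (G.mul x (G.inv e)) e = x := by
  rw [G.mul_assoc _ _ _ (by rw [G.t_inv, h]) (G.s_inv e), G.inv_mul, ← h, G.mul_unit]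

lemma mul_left_cancel (G : LieGroupoid.{u}) {a b c : G.Ar} (hb : G.s a = G.t b)
    (hc : G.s a = G.t c) (h : G.mul a b = G.mul a c) : b = c := by
  have key : ∀ d, G.s a = G.t d → G.mul (G.inv a) (G.mul a d) = d := fun d hd => by
    rw [← G.mul_assoc _ _ _ (G.s_inv a) hd, G.inv_mul, hd, G.unit_mul]
  rw [← key b hb, h, key c hc]

lemma mul_right_cancel (G : LieGroupoid.{u}) {a b c : G.Ar} (ha : G.s a = G.t c)
    (hb : G.s b = G.t c) (h : G.mul a c = G.mul b c) : a = b := by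
  have key : ∀ d, G.s d = G.t c → G.mul (G.mul d c) (G.inv c) = d := fun d hd => by
    rw [G.mul_assoc _ _ _ hd (G.t_inv c).symm, G.mul_inv, ← hd, G.mul_unit]
  rw [← key a ha, h, key b hb]

lemma mul_contMDiffOn (G : LieGroupoid.{u}) {X : Mfd.{u}} {U : Set X} {a b : X → G.Ar}
    (ha : ContMDiffOn (𝓡 X.dim) (𝓡 G.Ar.dim) ∞ a U)
    (hb : ContMDiffOn (𝓡 X.dim) (𝓡 G.Ar.dim) ∞ b U) (h : ∀ x ∈ U, G.s (a x) = G.t (b x)) :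
    ContMDiffOn (𝓡 X.dim) (𝓡 G.Ar.dim) ∞ (fun x => G.mul (a x) (b x)) U :=
  G.mul_smooth.comp (ha.prodMk hb) h

lemma Isomorphic.whiskerLeft {G G' G'' : LieGroupoid.{u}} {φ₁ φ₂ : Hom G G'} (ψ : Hom G' G'')
    (h : Isomorphic φ₁ φ₂) : Isomorphic (ψ.comp φ₁) (ψ.comp φ₂) := by
  obtain ⟨α, hs, h1, h2, h3⟩ := h
  refine ⟨fun x => ψ.ar (α x), ψ.ar_smooth.comp hs, fun x => ?_, fun x => ?_, fun g => ?_⟩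
  · rw [ψ.s_ar, h1]; rfl
  · rw [ψ.t_ar, h2]; rfl
  · change G''.mul (ψ.ar _) (ψ.ar (φ₁.ar g)) = G''.mul (ψ.ar (φ₂.ar g)) (ψ.ar _)
    rw [← ψ.ar_mul _ _ (by rw [h1, φ₁.t_ar]), ← ψ.ar_mul _ _ (by rw [h2, φ₂.s_ar]), h3]

lemma Isomorphic.whiskerRight {G G' G'' : LieGroupoid.{u}} {ψ₁ ψ₂ : Hom G' G''}
    (h : Isomorphic ψ₁ ψ₂) (φ : Hom G G') : Isomorphic (ψ₁.comp φ) (ψ₂.comp φ) := by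
  obtain ⟨α, hs, h1, h2, h3⟩ := h
  refine ⟨fun x => α (φ.ob x), hs.comp φ.ob_smooth, fun x => h1 _, fun x => h2 _, fun g => ?_⟩
  have := h3 (φ.ar g)
  rwa [φ.s_ar, φ.t_ar] at this

/-! ### Working forms of fullness, faithfulness and essential surjectivity -/

/-- The lifting property of fully faithful maps, over an open subset of a manifold. -/
def LiftsArrows {H G : LieGroupoid.{u}} (φ : Hom H G) : Prop :=
  ∀ (X : Mfd.{u}) (U : Set X) (a b : X → H.Ob) (g : X → G.Ar), IsOpen U →
    ContMDiffOn (𝓡 X.dim) (𝓡 H.Ob.dim) ∞ a U → ContMDiffOn (𝓡 X.dim) (𝓡 H.Ob.dim) ∞ b U →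
    ContMDiffOn (𝓡 X.dim) (𝓡 G.Ar.dim) ∞ g U →
    (∀ x ∈ U, G.s (g x) = φ.ob (a x)) → (∀ x ∈ U, G.t (g x) = φ.ob (b x)) →
    ∃ c : X → H.Ar, ContMDiffOn (𝓡 X.dim) (𝓡 H.Ar.dim) ∞ c U ∧
      ∀ x ∈ U, H.s (c x) = a x ∧ H.t (c x) = b x ∧ φ.ar (c x) = g x

/-- Every object is locally, and smoothly, the target of an arrow from the image of `φ`. -/
def HasLocalSections {H G : LieGroupoid.{u}} (φ : Hom H G) : Prop :=
  ∀ y : G.Ob, ∃ (U : Set G.Ob) (σ : G.Ob → H.Ob) (τ : G.Ob → G.Ar), IsOpen U ∧ y ∈ U ∧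
    ContMDiffOn (𝓡 G.Ob.dim) (𝓡 H.Ob.dim) ∞ σ U ∧
    ContMDiffOn (𝓡 G.Ob.dim) (𝓡 G.Ar.dim) ∞ τ U ∧
    ∀ z ∈ U, G.s (τ z) = φ.ob (σ z) ∧ G.t (τ z) = z

/-- Arrows between objects in the image of `φ` are in the image of `φ`. -/
def IsFull {H G : LieGroupoid.{u}} (φ : Hom H G) : Prop :=
  ∀ (x y : H.Ob) (g : G.Ar), G.s g = φ.ob x → G.t g = φ.ob y →
    ∃ h, H.s h = x ∧ H.t h = y ∧ φ.ar h = g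

/-- Parallel arrows with the same image are equal. -/
def IsFaithful {H G : LieGroupoid.{u}} (φ : Hom H G) : Prop :=
  ∀ h h' : H.Ar, H.s h = H.s h' → H.t h = H.t h' → φ.ar h = φ.ar h' → h = h'

end LieGroupoid

/-- An open subset of a manifold. -/
noncomputable def LieGpd.Mfd.restrict (X : Mfd.{u}) (U : TopologicalSpace.Opens X) : Mfd.{u} where
  carrier := U
  dim := X.dim

namespace LieGroupoid

lemma FullyFaithful.isFull {H G : LieGroupoid.{u}} {φ : Hom H G} (hφ : FullyFaithful φ) :
    IsFull φ := by
  intro x y g hx hy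
  obtain ⟨h, h1, h2⟩ := hφ.exists_point (y, x) g (Prod.ext hy.symm hx.symm)
  exact ⟨h, congrArg Prod.snd h1, congrArg Prod.fst h1, h2⟩

lemma FullyFaithful.isFaithful {H G : LieGroupoid.{u}} {φ : Hom H G} (hφ : FullyFaithful φ) :
    IsFaithful φ := fun _ _ h1 h2 h3 =>
  hφ.embedding.injective (Prod.ext (Prod.ext h2 h1) h3)

/-- The universal property of the pullback is applied to the open set, regarded as a manifold in its
own right. -/
lemma FullyFaithful.liftsArrows {H G : LieGroupoid.{u}} {φ : Hom H G} (hφ : FullyFaithful φ) :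
    LiftsArrows φ := by
  intro X U a b g hU ha hb hg hs ht
  let V : TopologicalSpace.Opens X := ⟨U, hU⟩
  have hval : ContMDiff (𝓡 X.dim) (𝓡 X.dim) ∞ (Subtype.val : V → X) := contMDiff_subtype_val
  have ha' := ha.comp_contMDiff hval fun x => x.2
  have hb' := hb.comp_contMDiff hval fun x => x.2
  have hg' := hg.comp_contMDiff hval fun x => x.2
  obtain ⟨c, hc, hc1, hc2⟩ := hφ.lift (X.restrict V) (fun x : V => (b x, a x))
    (fun x : V => g x) (hb'.prodMk ha') hg'
    (fun x : V => Prod.ext (ht x x.2).symm (hs x x.2).symm)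
  -- The values outside `U` are arbitrary; units merely make the function total.
  let d : X → H.Ar := Function.extend (Subtype.val : V → X) c fun x => H.unit (a x)
  have hd : ∀ x : V, d x = c x := fun x => Subtype.val_injective.extend_apply _ _ x
  refine ⟨d, fun x hx => ?_, fun x hx => ?_⟩
  · refine ContMDiffAt.contMDiffWithinAt ?_
    rw [← contMDiffAt_subtype_iff (U := V) (x := ⟨x, hx⟩)]
    have : (fun x : V => d x) = c := funext hd
    rw [this]
    exact hc _
  · have h1 := hc1 ⟨x, hx⟩
    have h2 := hc2 ⟨x, hx⟩
    rw [hd ⟨x, hx⟩]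
    exact ⟨congrArg Prod.snd h1, congrArg Prod.fst h1, h2⟩

/-- A smooth map into the values of a relation which is functional and locally has smooth
sections. -/
lemma exists_smooth_of_local {X Y : Mfd.{u}} (R : X → Y → Prop)
    (huniq : ∀ x y y', R x y → R x y' → y = y')
    (hloc : ∀ x, ∃ (U : Set X) (σ : X → Y), IsOpen U ∧ x ∈ U ∧
      ContMDiffOn (𝓡 X.dim) (𝓡 Y.dim) ∞ σ U ∧ ∀ z ∈ U, R z (σ z)) :
    ∃ f : X → Y, Smooth f ∧ ∀ x, R x (f x) := by
  have hex : ∀ x, ∃ y, R x y := fun x => by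
    obtain ⟨U, σ, -, hx, -, h⟩ := hloc x
    exact ⟨_, h x hx⟩
  choose f hf using hex
  refine ⟨f, fun x => ?_, hf⟩
  obtain ⟨U, σ, hU, hx, hσ, h⟩ := hloc x
  refine (hσ.contMDiffAt (hU.mem_nhds hx)).congr_of_eventuallyEq ?_
  filter_upwards [hU.mem_nhds hx] with z hz
  exact huniq z _ _ (hf z) (h z hz)

/-! ### Descent of isomorphisms along refinements -/

/-- Conjugating `φ(g)` by `ε` gives an arrow between values of `χ`, which lifts to some `j` in `C`.
Naturality of `ε` at `j` yields `φ(k(j)) = φ(g)`, and faithfulness of `φ` removes `φ`. -/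
lemma isFull_of_comp {C B G : LieGroupoid.{u}} {k : Hom C B} {φ : Hom B G} {χ : Hom C G}
    (h : Isomorphic (φ.comp k) χ) (hφ : IsFaithful φ) (hχ : IsFull χ) : IsFull k := by
  obtain ⟨ε, -, h1, h2, h3⟩ := h
  intro x y g hx hy
  change ∀ x, G.s (ε x) = φ.ob (k.ob x) at h1
  change ∀ j, G.mul (ε (C.t j)) (φ.ar (k.ar j)) = G.mul (χ.ar j) (ε (C.s j)) at h3
  have e1 : G.s (ε y) = G.t (φ.ar g) := by rw [h1, φ.t_ar, hy]
  have e2 : G.s (G.mul (ε y) (φ.ar g)) = G.s (ε x) := by rw [G.s_mul _ _ e1, φ.s_ar, hx, h1]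
  have e3 : G.s (G.mul (ε y) (φ.ar g)) = G.t (G.inv (ε x)) := by rw [e2, G.t_inv]
  obtain ⟨j, j1, j2, j3⟩ := hχ x y (G.mul (G.mul (ε y) (φ.ar g)) (G.inv (ε x)))
    (by rw [G.s_mul _ _ e3, G.s_inv, h2]) (by rw [G.t_mul _ _ e3, G.t_mul _ _ e1, h2])
  refine ⟨j, j1, j2, hφ _ _ (by rw [k.s_ar, j1, hx]) (by rw [k.t_ar, j2, hy]) ?_⟩
  have := h3 j
  rw [j1, j2, j3, G.mul_inv_mul_right e2] at this
  exact G.mul_left_cancel (by rw [h1, φ.t_ar, k.t_ar, j2]) e1 this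

/-- A local section for `χ` near `φ(y)` is pulled back along `φ`. Composed with `ε`, its arrows run
from `φ(k(σ(φ(z))))` to `φ(z)`, so they lift to arrows of `B` ending at `z`. -/
lemma hasLocalSections_of_comp {C B G : LieGroupoid.{u}} {k : Hom C B} {φ : Hom B G}
    {χ : Hom C G} (h : Isomorphic (φ.comp k) χ) (hφ : LiftsArrows φ)
    (hχ : HasLocalSections χ) : HasLocalSections k := by
  obtain ⟨ε, hε, h1, h2, -⟩ := h
  change ∀ x, G.s (ε x) = φ.ob (k.ob x) at h1
  intro y
  obtain ⟨U, σ, τ, hU, hy, hσ, hτ, hs⟩ := hχ (φ.ob y)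
  have hm : Set.MapsTo φ.ob (φ.ob ⁻¹' U) U := fun _ hx => hx
  have hV : IsOpen (φ.ob ⁻¹' U) := hU.preimage φ.ob_smooth.continuous
  have hσ' := hσ.comp φ.ob_smooth.contMDiffOn hm
  have hτ' := hτ.comp φ.ob_smooth.contMDiffOn hm
  have e : ∀ z ∈ φ.ob ⁻¹' U, G.s (τ (φ.ob z)) = G.t (ε (σ (φ.ob z))) := fun z hz => by
    rw [(hs _ hz).1, h2]
  obtain ⟨c, hc, hc'⟩ := hφ B.Ob (φ.ob ⁻¹' U) (fun z => k.ob (σ (φ.ob z))) (fun z => z)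
    (fun z => G.mul (τ (φ.ob z)) (ε (σ (φ.ob z)))) hV
    (k.ob_smooth.comp_contMDiffOn hσ') contMDiffOn_id
    (G.mul_contMDiffOn hτ' (hε.comp_contMDiffOn hσ') e)
    (fun z hz => by rw [G.s_mul _ _ (e z hz), h1])
    (fun z hz => by rw [G.t_mul _ _ (e z hz), (hs _ hz).2])
  exact ⟨_, fun z => σ (φ.ob z), c, hV, hy, hσ', hc, fun z hz => ⟨(hc' z hz).1, (hc' z hz).2.1⟩⟩

/-- Isomorphisms of maps descend along essentially surjective full maps. -/
lemma isomorphic_of_comp {C B G : LieGroupoid.{u}} {k : Hom C B} (hf : IsFull k)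
    (hl : HasLocalSections k) {p q : Hom B G} (h : Isomorphic (p.comp k) (q.comp k)) :
    Isomorphic p q := by
  obtain ⟨α, hα, h1, h2, h3⟩ := h
  change ∀ x, G.s (α x) = p.ob (k.ob x) at h1
  change ∀ x, G.t (α x) = q.ob (k.ob x) at h2
  change ∀ j, G.mul (α (C.t j)) (p.ar (k.ar j)) = G.mul (q.ar (k.ar j)) (α (C.s j)) at h3
  -- This encodes `b = q(e) α(x) p(e)⁻¹` for some arrow `e : k(x) → y`, the only value at `y` that
  -- naturality allows.
  let R : B.Ob → G.Ar → Prop := fun y b => ∃ x e, B.s e = k.ob x ∧ B.t e = y ∧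
    G.s b = p.ob y ∧ G.t b = q.ob y ∧ G.mul b (p.ar e) = G.mul (q.ar e) (α x)
  -- the value of a section over `y` is natural for arrows `y → y'`
  have nat : ∀ g b b', R (B.s g) b → R (B.t g) b' → G.mul b' (p.ar g) = G.mul (q.ar g) b := by
    rintro g b b' ⟨x, e, he, he', hb, hb', hbe⟩ ⟨y, d, hd, hd', hc, hc', hcd⟩
    have c1 : B.s g = B.t e := he'.symm
    have c2 : B.t d = B.t (B.mul g e) := by rw [B.t_mul _ _ c1, hd']
    have c3 : B.s (B.inv d) = B.t (B.mul g e) := by rw [B.s_inv, c2]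
    -- By fullness `d⁻¹ g e` is the image under `k` of an arrow `x → y`, where the naturality of `α`
    -- is available.
    obtain ⟨j, j1, j2, j3⟩ := hf x y (B.mul (B.inv d) (B.mul g e))
      (by rw [B.s_mul _ _ c3, B.s_mul _ _ c1, he]) (by rw [B.t_mul _ _ c3, B.t_inv, hd])
    have c4 : B.s d = B.t (k.ar j) := by rw [k.t_ar, j2, hd]
    have hj : B.mul d (k.ar j) = B.mul g e := by rw [j3, B.mul_inv_mul c2]
    have n := h3 j
    rw [j1, j2] at n
    have P : G.mul (p.ar d) (p.ar (k.ar j)) = G.mul (p.ar g) (p.ar e) := by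
      rw [← p.ar_mul _ _ c4, hj, p.ar_mul _ _ c1]
    have Q : G.mul (q.ar d) (q.ar (k.ar j)) = G.mul (q.ar g) (q.ar e) := by
      rw [← q.ar_mul _ _ c4, hj, q.ar_mul _ _ c1]
    have s1 : G.s b' = G.t (p.ar g) := by rw [hc, p.t_ar]
    have s2 : G.s (p.ar g) = G.t (p.ar e) := by rw [p.s_ar, p.t_ar, c1]
    have s3 : G.s b' = G.t (p.ar d) := by rw [hc, p.t_ar, hd']
    have s4 : G.s (p.ar d) = G.t (p.ar (k.ar j)) := by rw [p.s_ar, p.t_ar, c4]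
    have s5 : G.s (q.ar d) = G.t (α y) := by rw [q.s_ar, h2, hd]
    have s6 : G.s (α y) = G.t (p.ar (k.ar j)) := by rw [h1, p.t_ar, k.t_ar, j2]
    have s7 : G.s (q.ar d) = G.t (q.ar (k.ar j)) := by rw [q.s_ar, q.t_ar, c4]
    have s8 : G.s (q.ar (k.ar j)) = G.t (α x) := by rw [q.s_ar, h2, k.s_ar, j1]
    have s9 : G.s (q.ar g) = G.t (q.ar e) := by rw [q.s_ar, q.t_ar, c1]
    have s10 : G.s (q.ar e) = G.t (α x) := by rw [q.s_ar, h2, he]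
    have s11 : G.s (q.ar g) = G.t b := by rw [q.s_ar, hb']
    have s12 : G.s b = G.t (p.ar e) := by rw [hb, p.t_ar, he']
    refine G.mul_right_cancel (c := p.ar e) (by rw [G.s_mul _ _ s1, s2])
      (by rw [G.s_mul _ _ s11, s12]) ?_
    rw [G.mul_assoc _ _ _ s1 s2, ← P, ← G.mul_assoc _ _ _ s3 s4, hcd, G.mul_assoc _ _ _ s5 s6, n,
      ← G.mul_assoc _ _ _ s7 s8, Q, G.mul_assoc _ _ _ s9 s10, ← hbe, G.mul_assoc _ _ _ s11 s12]
  have huniq : ∀ y b b', R y b → R y b' → b = b' := by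
    intro y b b' hb hb'
    -- Naturality at a unit arrow says precisely that the value is unique.
    have n := nat (B.unit y) b b' (by rwa [B.s_unit]) (by rwa [B.t_unit])
    obtain ⟨-, -, -, -, e1, e2, -⟩ := hb
    obtain ⟨-, -, -, -, e3, e4, -⟩ := hb'
    rw [p.ar_unit, q.ar_unit, ← e3, ← e2, G.mul_unit, G.unit_mul] at n
    exact n.symm
  have hloc : ∀ y, ∃ (U : Set B.Ob) (σ : B.Ob → G.Ar), IsOpen U ∧ y ∈ U ∧
      ContMDiffOn (𝓡 B.Ob.dim) (𝓡 G.Ar.dim) ∞ σ U ∧ ∀ z ∈ U, R z (σ z) := by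
    intro y
    obtain ⟨U, σ, τ, hU, hy, hσ, hτ, hs⟩ := hl y
    have c1 : ∀ z ∈ U, G.s (q.ar (τ z)) = G.t (α (σ z)) := fun z hz => by
      rw [q.s_ar, (hs z hz).1, h2]
    have c2 : ∀ z ∈ U, G.s (G.mul (q.ar (τ z)) (α (σ z))) = G.s (p.ar (τ z)) := fun z hz => by
      rw [G.s_mul _ _ (c1 z hz), h1, p.s_ar, (hs z hz).1]
    have c3 : ∀ z ∈ U, G.s (G.mul (q.ar (τ z)) (α (σ z))) = G.t (G.inv (p.ar (τ z))) :=
      fun z hz => by rw [c2 z hz, G.t_inv]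
    refine ⟨U, fun z => G.mul (G.mul (q.ar (τ z)) (α (σ z))) (G.inv (p.ar (τ z))), hU, hy,
      G.mul_contMDiffOn (G.mul_contMDiffOn (q.ar_smooth.comp_contMDiffOn hτ)
        (hα.comp_contMDiffOn hσ) c1)
        (G.inv_smooth.comp_contMDiffOn (p.ar_smooth.comp_contMDiffOn hτ)) c3, fun z hz => ?_⟩
    refine ⟨σ z, τ z, (hs z hz).1, (hs z hz).2, ?_, ?_, ?_⟩
    · rw [G.s_mul _ _ (c3 z hz), G.s_inv, p.t_ar, (hs z hz).2]
    · rw [G.t_mul _ _ (c3 z hz), G.t_mul _ _ (c1 z hz), q.t_ar, (hs z hz).2]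
    · rw [G.mul_inv_mul_right (c2 z hz)]
  obtain ⟨β, hβ, hβR⟩ := exists_smooth_of_local R huniq hloc
  refine ⟨β, hβ, fun y => ?_, fun y => ?_, fun g => nat g _ _ (hβR _) (hβR _)⟩
  · obtain ⟨x, e, -, -, h, -⟩ := hβR y
    exact h
  · obtain ⟨x, e, -, -, -, h, -⟩ := hβR y
    exact h

end LieGroupoid

/-! ### Local sections from the inverse function theorem -/

/-- A smooth map between finite-dimensional spaces with surjective derivative at a point has a
smooth section over a neighbourhood of the value. -/
lemma ContDiffOn.exists_local_section {E F : Type*} [NormedAddCommGroup E] [NormedSpace ℝ E]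
    [NormedAddCommGroup F] [NormedSpace ℝ F] [FiniteDimensional ℝ F]
    {f : E → F} {Ω : Set E} {p : E} {f' : E →L[ℝ] F} (hΩ : IsOpen Ω) (hp : p ∈ Ω)
    (hf : ContDiffOn ℝ ∞ f Ω) (hf' : HasFDerivAt f f' p) (hsurj : Function.Surjective f') :
    ∃ (V : Set F) (ρ : F → E), IsOpen V ∧ f p ∈ V ∧ ContDiffOn ℝ ∞ ρ V ∧
      ∀ z ∈ V, ρ z ∈ Ω ∧ f (ρ z) = z := by
  have : CompleteSpace F := FiniteDimensional.complete ℝ F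
  obtain ⟨R, hR⟩ := f'.exists_rightInverse_of_surjective (LinearMap.range_eq_top.2 hsurj)
  -- On the affine slice through `p` in the direction of a right inverse of `f'`, the derivative of
  -- `f` at `p` becomes the identity, so the inverse function theorem applies.
  let a : F → E := fun y => p + R y
  have ha : ContDiff ℝ ∞ a := contDiff_const.add R.contDiff
  have ha' : ∀ y, HasFDerivAt a R y := fun y => R.hasFDerivAt.const_add p
  have ha0 : a 0 = p := by simp [a]
  let Ω' : Set F := a ⁻¹' Ω
  have hΩ' : IsOpen Ω' := hΩ.preimage ha.continuous
  have h0 : (0 : F) ∈ Ω' := by change a 0 ∈ Ω; rwa [ha0]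
  let g : F → F := fun y => f (a y)
  have hg : ContDiffOn ℝ ∞ g Ω' := hf.comp ha.contDiffOn fun _ h => h
  have hgat : ∀ y ∈ Ω', ContDiffAt ℝ ∞ g y := fun y hy => hg.contDiffAt (hΩ'.mem_nhds hy)
  have hg0 : HasFDerivAt g ((ContinuousLinearEquiv.refl ℝ F : F ≃L[ℝ] F) : F →L[ℝ] F) 0 := by
    have h1 : HasFDerivAt f f' (a 0) := by rwa [ha0]
    have h2 := h1.comp (0 : F) (ha' 0)
    rw [hR] at h2
    exact h2
  let e := (hgat 0 h0).toOpenPartialHomeomorph g hg0 (by simp)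
  have he : ∀ y, e y = g y := fun _ => rfl
  -- The local inverse is smooth at `z` only where the derivative of `g` at its preimage is
  -- invertible. This is an open condition, so the target is shrunk to these points.
  let S : Set F := Ω' ∩ fderiv ℝ g ⁻¹' Set.range ((↑) : (F ≃L[ℝ] F) → F →L[ℝ] F)
  have hS : IsOpen S := (hg.continuousOn_fderiv_of_isOpen hΩ' (by simp)).isOpen_inter_preimage hΩ'
    ContinuousLinearEquiv.isOpen
  have h0S : (0 : F) ∈ S := ⟨h0, _, hg0.fderiv.symm⟩
  refine ⟨e.target ∩ e.symm ⁻¹' S, fun z => a (e.symm z), e.isOpen_inter_preimage_symm hS, ?_, ?_,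
    fun z hz => ⟨hz.2.1, ?_⟩⟩
  · have h0e : (0 : F) ∈ e.source :=
      (hgat 0 h0).mem_toOpenPartialHomeomorph_source hg0 (by simp)
    have : f p = e 0 := by rw [he, ← ha0]
    rw [this]
    refine ⟨e.map_source h0e, ?_⟩
    rw [Set.mem_preimage, e.left_inv h0e]
    exact h0S
  · rintro z ⟨hz, hzΩ, A, hA⟩
    have hc := hgat _ hzΩ
    have hd : HasFDerivAt g (A : F →L[ℝ] F) (e.symm z) := by
      rw [hA]
      exact (hc.differentiableAt (by simp)).hasFDerivAt
    exact (ha.contDiffAt.comp z (e.contDiffAt_symm hz hd hc)).contDiffWithinAt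
  · exact e.right_inv hz.1

/-- If `(v, w) ↦ dh v` is surjective on the fibre product of the derivatives `df` and `dk`, and `df`
is surjective, then `h` has smooth local sections on the solutions of `f u = k v`. -/
lemma ContDiffOn.exists_local_section_of_fiberProduct {E₁ E₂ F₁ F₂ : Type*}
    [NormedAddCommGroup E₁] [NormedSpace ℝ E₁] [NormedAddCommGroup E₂] [NormedSpace ℝ E₂]
    [NormedAddCommGroup F₁] [NormedSpace ℝ F₁] [FiniteDimensional ℝ F₁]
    [NormedAddCommGroup F₂] [NormedSpace ℝ F₂] [FiniteDimensional ℝ F₂]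
    {h : E₁ → F₁} {f : E₁ → F₂} {k : E₂ → F₂} {Ωh Ωf : Set E₁} {Ωk : Set E₂} {p : E₁} {q : E₂}
    {h' : E₁ →L[ℝ] F₁} {f' : E₁ →L[ℝ] F₂} {k' : E₂ →L[ℝ] F₂}
    (Hh : IsOpen Ωh ∧ p ∈ Ωh ∧ ContDiffOn ℝ ∞ h Ωh ∧ HasFDerivAt h h' p)
    (Hf : IsOpen Ωf ∧ p ∈ Ωf ∧ ContDiffOn ℝ ∞ f Ωf ∧ HasFDerivAt f f' p)
    (Hk : IsOpen Ωk ∧ q ∈ Ωk ∧ ContDiffOn ℝ ∞ k Ωk ∧ HasFDerivAt k k' q)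
    (hpq : f p = k q) (hf' : Function.Surjective f')
    (hh' : ∀ a, ∃ v w, f' v = k' w ∧ h' v = a) :
    ∃ (V : Set F₁) (ρ₁ : F₁ → E₁) (ρ₂ : F₁ → E₂), IsOpen V ∧ h p ∈ V ∧ ContDiffOn ℝ ∞ ρ₁ V ∧
      ContDiffOn ℝ ∞ ρ₂ V ∧ ∀ z ∈ V, ρ₁ z ∈ Ωh ∧ ρ₁ z ∈ Ωf ∧ ρ₂ z ∈ Ωk ∧ h (ρ₁ z) = z ∧
        f (ρ₁ z) = k (ρ₂ z) := by
  obtain ⟨oh, mh, ch, dh⟩ := Hh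
  obtain ⟨of, mf, cf, df⟩ := Hf
  obtain ⟨ok, mk, ck, dk⟩ := Hk
  have hpr1 : ContDiff ℝ ∞ (Prod.fst : E₁ × E₂ → E₁) := contDiff_fst
  have hpr2 : ContDiff ℝ ∞ (Prod.snd : E₁ × E₂ → E₂) := contDiff_snd
  -- The constraint `f u = k v` becomes a second component of the map; a section of the pair over
  -- the slice `(z, 0)` is the required section on solutions.
  have hcd : ContDiffOn ℝ ∞ (fun u : E₁ × E₂ => (h u.1, f u.1 - k u.2)) ((Ωh ∩ Ωf) ×ˢ Ωk) :=
    (ch.comp hpr1.contDiffOn fun u hu => hu.1.1).prodMk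
      ((cf.comp hpr1.contDiffOn fun u hu => hu.1.2).sub
        (ck.comp hpr2.contDiffOn fun u hu => hu.2))
  have hder : HasFDerivAt (fun u : E₁ × E₂ => (h u.1, f u.1 - k u.2))
      ((h'.comp (ContinuousLinearMap.fst ℝ E₁ E₂)).prod (f'.comp (ContinuousLinearMap.fst ℝ E₁ E₂) -
        k'.comp (ContinuousLinearMap.snd ℝ E₁ E₂))) (p, q) :=
    (dh.comp (p, q) hasFDerivAt_fst).prodMk
      ((df.comp (p, q) hasFDerivAt_fst).sub (dk.comp (p, q) hasFDerivAt_snd))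
  obtain ⟨V, ρ, hV, hpV, hρ, hρ'⟩ := hcd.exists_local_section ((oh.inter of).prod ok)
    (Set.mk_mem_prod (Set.mem_inter mh mf) mk) hder (by
      -- A preimage `v` of `b` under `f'` handles the second component; a tangent vector of the
      -- fibre product then corrects the first without disturbing it.
      rintro ⟨a, b⟩
      obtain ⟨v, hv⟩ := hf' b
      obtain ⟨v', w', h1, h2⟩ := hh' (a - h' v)
      exact ⟨(v + v', w'), Prod.ext (by simp [h2]) (by simp [hv, h1])⟩)
  have hc : ContDiff ℝ ∞ fun z : F₁ => (z, (0 : F₂)) := contDiff_id.prodMk contDiff_const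
  have hρc := hρ.comp (s := (fun z : F₁ => (z, (0 : F₂))) ⁻¹' V) hc.contDiffOn fun _ hz => hz
  refine ⟨_, fun z => (ρ (z, 0)).1, fun z => (ρ (z, 0)).2, hV.preimage hc.continuous, ?_,
    hpr1.comp_contDiffOn hρc, hpr2.comp_contDiffOn hρc, fun z hz => ?_⟩
  · change (h p, (0 : F₂)) ∈ V
    simpa [hpq] using hpV
  · obtain ⟨⟨⟨m1, m2⟩, m3⟩, e⟩ := hρ' _ hz
    exact ⟨m1, m2, m3, congrArg Prod.fst e, sub_eq_zero.1 (congrArg Prod.snd e)⟩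

namespace LieGpd

/-- The representative of a smooth map in the preferred charts at a point and its image. -/
lemma Smooth.chart_rep {M N : Mfd.{u}} {f : M → N} (hf : Smooth f) {x : M} {y : N}
    (hxy : f x = y) {Ω : Set (EuclideanSpace ℝ (Fin M.dim))}
    (hΩ : Ω = (extChartAt (𝓡 M.dim) x).target ∩
      (extChartAt (𝓡 M.dim) x).symm ⁻¹' (f ⁻¹' (extChartAt (𝓡 N.dim) y).source))
    {F : EuclideanSpace ℝ (Fin M.dim) → EuclideanSpace ℝ (Fin N.dim)}
    (hF : F = fun u => extChartAt (𝓡 N.dim) y (f ((extChartAt (𝓡 M.dim) x).symm u))) :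
    IsOpen Ω ∧ extChartAt (𝓡 M.dim) x x ∈ Ω ∧ ContDiffOn ℝ ∞ F Ω ∧
      HasFDerivAt F (tangent f x : EuclideanSpace ℝ (Fin M.dim) →L[ℝ] EuclideanSpace ℝ (Fin N.dim))
        (extChartAt (𝓡 M.dim) x x) := by
  subst hxy
  have hopen : IsOpen Ω := by
    rw [hΩ]
    exact (continuousOn_extChartAt_symm x).isOpen_inter_preimage (isOpen_extChartAt_target x)
      ((isOpen_extChartAt_source (f x)).preimage hf.continuous)
  have hmem : extChartAt (𝓡 M.dim) x x ∈ Ω := by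
    rw [hΩ]
    refine ⟨mem_extChartAt_target x, ?_⟩
    rw [Set.mem_preimage, extChartAt_to_inv, Set.mem_preimage]
    exact mem_extChartAt_source _
  refine ⟨hopen, hmem, ?_, ?_⟩
  · rw [← contMDiffOn_iff_contDiffOn, hF, hΩ]
    refine (contMDiffOn_extChartAt (x := f x)).comp (hf.comp_contMDiffOn
      ((contMDiffOn_extChartAt_symm x).mono Set.inter_subset_left)) fun u hu => ?_
    rw [← extChartAt_source (𝓡 N.dim)]
    exact hu.2
  · have hd : MDifferentiableAt (𝓡 M.dim) (𝓡 N.dim) f x := hf.mdifferentiableAt (by simp)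
    have h := hd.hasMFDerivAt.2
    -- Without boundary, the derivative within the range of the model is an ordinary derivative.
    rw [ModelWithCorners.range_eq_univ] at h
    rw [hF]
    exact hasFDerivWithinAt_univ.1 h

end LieGpd

namespace LieGroupoid

/-- In charts, the pairs `(g, x)` with `s g = φ x` are the solutions of an equation whose
linearization is the fibre product of tangent spaces. Since `s` is a submersion and `t` is
submersive on these pairs, `t` has local sections among them. -/
lemma EssentiallySurjective.hasLocalSections {H G : LieGroupoid.{u}} {φ : Hom H G}
    (hφ : EssentiallySurjective φ) : HasLocalSections φ := by
  intro y
  obtain ⟨g, x, hgx, hgy⟩ := hφ.surjective y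
  let eg := extChartAt (𝓡 G.Ar.dim) g
  let ex := extChartAt (𝓡 H.Ob.dim) x
  let ey := extChartAt (𝓡 G.Ob.dim) y
  let ez := extChartAt (𝓡 G.Ob.dim) (G.s g)
  obtain ⟨V, ρ₁, ρ₂, hV, hpV, hρ₁, hρ₂, hρ⟩ := ContDiffOn.exists_local_section_of_fiberProduct
    (Smooth.chart_rep G.t_submersion.smooth hgy rfl rfl)
    (Smooth.chart_rep G.s_submersion.smooth rfl rfl rfl)
    (Smooth.chart_rep φ.ob_smooth hgx.symm rfl rfl)
    (by rw [extChartAt_to_inv, extChartAt_to_inv, hgx]) (G.s_submersion.surjective g)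
    (hφ.submersion g x hgx)
  rw [extChartAt_to_inv, hgy] at hpV
  have hey : ContMDiffOn (𝓡 G.Ob.dim) 𝓘(ℝ, EuclideanSpace ℝ (Fin G.Ob.dim)) ∞ ey
      (ey.source ∩ ey ⁻¹' V) := by
    refine ContMDiffOn.mono contMDiffOn_extChartAt fun z hz => ?_
    rw [← extChartAt_source (𝓡 G.Ob.dim)]
    exact hz.1
  refine ⟨ey.source ∩ ey ⁻¹' V, fun z => ex.symm (ρ₂ (ey z)), fun z => eg.symm (ρ₁ (ey z)),
    (continuousOn_extChartAt y).isOpen_inter_preimage (isOpen_extChartAt_source y) hV,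
    ⟨mem_extChartAt_source y, hpV⟩, ?_, ?_, fun z hz => ?_⟩
  · exact (contMDiffOn_extChartAt_symm x).comp (hρ₂.contMDiffOn.comp hey fun z hz => hz.2)
      fun z hz => (hρ _ hz.2).2.2.1.1
  · exact (contMDiffOn_extChartAt_symm g).comp (hρ₁.contMDiffOn.comp hey fun z hz => hz.2)
      fun z hz => (hρ _ hz.2).1.1
  · obtain ⟨m1, m2, m3, h1, h2⟩ := hρ _ hz.2
    -- The equations hold in coordinates; all points lie in the chart domains, where the charts are
    -- injective.
    exact ⟨ez.injOn m2.2 m3.2 h2, ey.injOn m1.2 hz.1 h1⟩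

end LieGroupoid

/-! ### Comparing fractions with maps of groupoids -/

namespace LieGroupoid

/-- The forward direction restricts along `h`. The converse descends along `h`, which is full and
has local sections because `a.φ` composed with `h` is isomorphic to a weak equivalence. -/
lemma Fraction.isomorphic_iff_of_refinement {G G' : LieGroupoid.{u}} (θ : Hom G G')
    {a c : Fraction G G'} {h : Hom c.H a.H} (hφ : Isomorphic (a.φ.comp h) c.φ)
    (hψ : Isomorphic (a.ψ.comp h) c.ψ) :
    Isomorphic a.ψ (θ.comp a.φ) ↔ Isomorphic c.ψ (θ.comp c.φ) := by
  refine ⟨fun H => hψ.symm.trans ((H.whiskerRight h).trans (hφ.whiskerLeft θ)), fun H => ?_⟩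
  exact isomorphic_of_comp
    (isFull_of_comp hφ a.weq.fullyFaithful.isFaithful c.weq.fullyFaithful.isFull)
    (hasLocalSections_of_comp hφ a.weq.fullyFaithful.liftsArrows
      c.weq.essentiallySurjective.hasLocalSections)
    (hψ.trans (H.trans (hφ.whiskerLeft θ).symm))

lemma FractionRel.isomorphic_iff {G G' : LieGroupoid.{u}} (θ : Hom G G')
    {a b : Fraction G G'} (h : FractionRel a b) :
    Isomorphic a.ψ (θ.comp a.φ) ↔ Isomorphic b.ψ (θ.comp b.φ) := by
  obtain ⟨c, h, k, h1, h2, h3, h4⟩ := h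
  exact (Fraction.isomorphic_iff_of_refinement θ h1 h2).trans
    (Fraction.isomorphic_iff_of_refinement θ h3 h4).symm

/-- A fraction `ψ/φ` presents the generalized map `θ/1` if and only if `ψ ≅ θ φ`. -/
lemma Fraction.toGenMap_eq_iff {G G' : LieGroupoid.{u}} (θ : Hom G G') (a : Fraction G G') :
    a.toGenMap = θ.toGenMap ↔ Isomorphic a.ψ (θ.comp a.φ) := by
  refine ⟨fun h => ?_, fun h => ?_⟩
  · have e := congrArg (Quot.lift (fun a : Fraction G G' => Isomorphic a.ψ (θ.comp a.φ))
      fun _ _ r => propext (r.isomorphic_iff θ)) h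
    exact e.mpr (Isomorphic.refl θ)
  -- The fraction `a` itself is the common refinement, mapping to `G` by `a.φ`.
  · exact Quot.sound ⟨a, Hom.id _, a.φ, .refl _, .refl _, .refl _, h.symm⟩

lemma Hom.toGenMap_eq_iff {G G' : LieGroupoid.{u}} (θ₁ θ₂ : Hom G G') :
    θ₁.toGenMap = θ₂.toGenMap ↔ Isomorphic θ₁ θ₂ :=
  Fraction.toGenMap_eq_iff θ₂ _

/-! ### From a commutative square to a map of groupoids -/

/-- If `F ∘ π = π' ∘ f`, a fraction `ψ/φ` of `F` is trivialized over a cover `w` of `M`. -/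
lemma CommSquare.exists_cover {G G' : LieGroupoid.{u}} (S : CommSquare G G') :
    ∃ (a : Fraction G G') (K : LieGroupoid.{u}) (w : Hom K (ofMfd G.Ob)) (l : Hom K a.H),
      a.toGenMap = S.F ∧ IsWeakEquivalence w ∧
      Isomorphic (a.φ.comp l) (G.presentation.comp w) ∧
      Isomorphic (a.ψ.comp l)
        ((G'.presentation.comp (homOfSmooth S.f S.f_smooth)).comp w) := by
  obtain ⟨E, ⟨b, b', L, κ', l', -, hw', i', hb, hb', hE'⟩, ⟨a, a', K, κ, l, -, hw, i, ha, ha', hE⟩⟩ :=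
    S.comm
  rw [Fraction.toGenMap_eq_iff] at hb hb' ha
  -- One description of the composite identifies it with an honest map of groupoids over `1`. The
  -- criterion for such maps then turns the other description into an isomorphism over `K`.
  have hE'' : E = (G'.presentation.comp (homOfSmooth S.f S.f_smooth)).toGenMap := by
    rw [← hE', Fraction.toGenMap_eq_iff]
    exact (hb'.whiskerRight l').trans
      ((i'.symm.trans (hb.whiskerRight κ')).whiskerLeft G'.presentation)
  rw [hE'', Fraction.toGenMap_eq_iff] at hE
  exact ⟨a', K, a.φ.comp κ, l, ha', hw, i.symm.trans (ha.whiskerRight κ), hE⟩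

/-- Since `w` is full onto a unit groupoid, points of one fibre are joined by an arrow `k` of `K`.
Its images in `G` and `G'` through `w` are units, so naturality of `β` and `γ` at `k` gives both
identities, with `j = l(k)`. -/
lemma exists_cover_transition {H G G' K : LieGroupoid.{u}} {φ : Hom H G} {ψ : Hom H G'}
    {w : Hom K (ofMfd G.Ob)} {l : Hom K H} {f : Hom (ofMfd G.Ob) (ofMfd G'.Ob)}
    {β : K.Ob → G.Ar} {γ : K.Ob → G'.Ar} (hw : IsFull w)
    (hβ : IsHomIso (φ.comp l) (G.presentation.comp w) β)
    (hγ : IsHomIso (ψ.comp l) ((G'.presentation.comp f).comp w) γ)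
    {p q : K.Ob} (hpq : w.ob p = w.ob q) :
    ∃ j, H.s j = l.ob p ∧ H.t j = l.ob q ∧ G.mul (β q) (φ.ar j) = β p ∧
      G'.mul (γ q) (ψ.ar j) = γ p := by
  obtain ⟨k, hk1, hk2, -⟩ := hw p q (w.ob p) rfl hpq
  have n := hβ.naturality k
  have n' := hγ.naturality k
  change G.mul _ _ = G.mul (G.unit (w.ar k)) _ at n
  change G'.mul _ _ = G'.mul (G'.unit (f.ar (w.ar k))) _ at n'
  have e : w.ar k = w.ob p := hk1 ▸ w.s_ar k
  have e' : f.ar (w.ob p) = f.ob (w.ob p) := f.s_ar _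
  have e1 : G.t (β p) = w.ob p := hβ.t_eq p
  have e2 : G'.t (γ p) = f.ob (w.ob p) := hγ.t_eq p
  rw [hk1, hk2, e] at n n'
  rw [← e1, G.unit_mul] at n
  rw [e', ← e2, G'.unit_mul] at n'
  exact ⟨l.ar k, by rw [l.s_ar, hk1], by rw [l.t_ar, hk2], n, n'⟩

/-- A generalized map which is trivialized over a cover of the objects, compatibly with `f`, is
given by a map of Lie groupoids over `f`. -/
lemma exists_hom_of_cover {H G G' : LieGroupoid.{u}} {C : Mfd.{u}} {φ : Hom H G} {ψ : Hom H G'}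
    (hφ : IsFull φ) (hφ' : IsFaithful φ) (hlift : LiftsArrows φ)
    {w : C → G.Ob} {l : C → H.Ob} {f : G.Ob → G'.Ob} {β : C → G.Ar} {γ : C → G'.Ar}
    (hl : Smooth l) (hf : Smooth f) (hβ : Smooth β) (hγ : Smooth γ)
    (hβs : ∀ p, G.s (β p) = φ.ob (l p)) (hβt : ∀ p, G.t (β p) = w p)
    (hγs : ∀ p, G'.s (γ p) = ψ.ob (l p)) (hγt : ∀ p, G'.t (γ p) = f (w p))
    (hsec : ∀ x, ∃ (U : Set G.Ob) (σ : G.Ob → C), IsOpen U ∧ x ∈ U ∧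
      ContMDiffOn (𝓡 G.Ob.dim) (𝓡 C.dim) ∞ σ U ∧ ∀ z ∈ U, w (σ z) = z)
    (htrans : ∀ p q, w p = w q → ∃ j, H.s j = l p ∧ H.t j = l q ∧
      G.mul (β q) (φ.ar j) = β p ∧ G'.mul (γ q) (ψ.ar j) = γ p) :
    ∃ θ : Hom G G', θ.ob = f ∧ Isomorphic ψ (θ.comp φ) := by
  have hsurj : ∀ x, ∃ p, w p = x := fun x => by
    obtain ⟨U, σ, -, hx, -, h⟩ := hsec x
    exact ⟨_, h x hx⟩
  -- This is `g' = γ(q) ψ(h) γ(p)⁻¹` with `φ(h) = β(q)⁻¹ g β(p)`, stated without inverses.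
  let R : G.Ar → G'.Ar → Prop := fun g g' => ∃ p q h, w p = G.s g ∧ w q = G.t g ∧ H.s h = l p ∧
    H.t h = l q ∧ G.mul g (β p) = G.mul (β q) (φ.ar h) ∧ G'.s g' = f (G.s g) ∧
    G'.t g' = f (G.t g) ∧ G'.mul g' (γ p) = G'.mul (γ q) (ψ.ar h)
  -- the value of `R` can be computed with any points over the source and the target
  have key : ∀ g g', R g g' → ∀ p q h, w p = G.s g → w q = G.t g → H.s h = l p →
      H.t h = l q → G.mul g (β p) = G.mul (β q) (φ.ar h) →
      G'.mul g' (γ p) = G'.mul (γ q) (ψ.ar h) := by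
    rintro g g' ⟨p', q', h', hp', hq', hs', ht', hg', hgs, hgt, hgg⟩ p q h hp hq hs ht hg
    obtain ⟨i, i1, i2, i3, i4⟩ := htrans p p' (hp.trans hp'.symm)
    obtain ⟨j, j1, j2, j3, j4⟩ := htrans q q' (hq.trans hq'.symm)
    have c1 : H.s h' = H.t i := by rw [hs', i2]
    have c2 : H.s j = H.t h := by rw [j1, ht]
    have b1 : G.s (β p') = G.t (φ.ar i) := by rw [hβs, φ.t_ar, i2]
    have b2 : G.s (β q') = G.t (φ.ar h') := by rw [hβs, φ.t_ar, ht']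
    have b3 : G.s (β q') = G.t (φ.ar j) := by rw [hβs, φ.t_ar, j2]
    have b4 : G.s (φ.ar h') = G.t (φ.ar i) := by rw [φ.s_ar, φ.t_ar, c1]
    have b5 : G.s (φ.ar j) = G.t (φ.ar h) := by rw [φ.s_ar, φ.t_ar, c2]
    have b6 : G.s g = G.t (β p') := by rw [hβt, hp']
    -- Both composites run from `l(p)` to `l(q')` and have the same image under `φ`, so they agree
    -- by faithfulness; applying `ψ` transfers this to `G'`.
    have hij : H.mul h' i = H.mul j h := by
      refine hφ' _ _ (by rw [H.s_mul _ _ c1, H.s_mul _ _ c2, i1, hs])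
        (by rw [H.t_mul _ _ c1, H.t_mul _ _ c2, ht', j2]) ?_
      rw [φ.ar_mul _ _ c1, φ.ar_mul _ _ c2]
      refine G.mul_left_cancel (a := β q') (by rw [G.t_mul _ _ b4, b2])
        (by rw [G.t_mul _ _ b5, b3]) ?_
      rw [← G.mul_assoc _ _ _ b2 b4, ← G.mul_assoc _ _ _ b3 b5, j3, ← hg', ← hg,
        G.mul_assoc _ _ _ b6 b1, i3]
    have d1 : G'.s (γ p') = G'.t (ψ.ar i) := by rw [hγs, ψ.t_ar, i2]
    have d2 : G'.s (γ q') = G'.t (ψ.ar h') := by rw [hγs, ψ.t_ar, ht']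
    have d3 : G'.s (γ q') = G'.t (ψ.ar j) := by rw [hγs, ψ.t_ar, j2]
    have d4 : G'.s (ψ.ar h') = G'.t (ψ.ar i) := by rw [ψ.s_ar, ψ.t_ar, c1]
    have d5 : G'.s (ψ.ar j) = G'.t (ψ.ar h) := by rw [ψ.s_ar, ψ.t_ar, c2]
    have d6 : G'.s g' = G'.t (γ p') := by rw [hγt, hgs, hp']
    rw [← i4, ← G'.mul_assoc _ _ _ d6 d1, hgg, G'.mul_assoc _ _ _ d2 d4, ← ψ.ar_mul _ _ c1, hij,
      ψ.ar_mul _ _ c2, ← G'.mul_assoc _ _ _ d3 d5, j4]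
  have huniq : ∀ g g' g'', R g g' → R g g'' → g' = g'' := by
    rintro g g' g'' hg' ⟨p, q, h, hp, hq, hs, ht, hg, hgs, hgt, hgg⟩
    have e := key g g' hg' p q h hp hq hs ht hg
    obtain ⟨-, -, -, -, -, -, -, -, hgs', -, -⟩ := hg'
    exact G'.mul_right_cancel (by rw [hgs', hγt, hp]) (by rw [hgs, hγt, hp]) (e.trans hgg.symm)
  have hloc : ∀ g, ∃ (U : Set G.Ar) (σ : G.Ar → G'.Ar), IsOpen U ∧ g ∈ U ∧
      ContMDiffOn (𝓡 G.Ar.dim) (𝓡 G'.Ar.dim) ∞ σ U ∧ ∀ z ∈ U, R z (σ z) := by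
    intro g
    obtain ⟨U, σ, hU, hgU, hσ, hσw⟩ := hsec (G.s g)
    obtain ⟨V, τ, hV, hgV, hτ, hτw⟩ := hsec (G.t g)
    let W : Set G.Ar := G.s ⁻¹' U ∩ G.t ⁻¹' V
    have hW : IsOpen W := (hU.preimage G.s_submersion.smooth.continuous).inter
      (hV.preimage G.t_submersion.smooth.continuous)
    have hσ' : ContMDiffOn (𝓡 G.Ar.dim) (𝓡 C.dim) ∞ (fun z => σ (G.s z)) W :=
      hσ.comp G.s_submersion.smooth.contMDiffOn fun z hz => hz.1
    have hτ' : ContMDiffOn (𝓡 G.Ar.dim) (𝓡 C.dim) ∞ (fun z => τ (G.t z)) W :=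
      hτ.comp G.t_submersion.smooth.contMDiffOn fun z hz => hz.2
    have c1 : ∀ z ∈ W, G.s z = G.t (β (σ (G.s z))) := fun z hz => by rw [hβt, hσw _ hz.1]
    have c2 : ∀ z ∈ W, G.t (β (τ (G.t z))) = G.t (G.mul z (β (σ (G.s z)))) := fun z hz => by
      rw [hβt, hτw _ hz.2, G.t_mul _ _ (c1 z hz)]
    have c3 : ∀ z ∈ W, G.s (G.inv (β (τ (G.t z)))) = G.t (G.mul z (β (σ (G.s z)))) :=
      fun z hz => by rw [G.s_inv, c2 z hz]
    obtain ⟨c, hc, hc'⟩ := hlift G.Ar W (fun z => l (σ (G.s z))) (fun z => l (τ (G.t z)))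
      (fun z => G.mul (G.inv (β (τ (G.t z)))) (G.mul z (β (σ (G.s z))))) hW
      (hl.comp_contMDiffOn hσ') (hl.comp_contMDiffOn hτ')
      (G.mul_contMDiffOn (G.inv_smooth.comp_contMDiffOn (hβ.comp_contMDiffOn hτ'))
        (G.mul_contMDiffOn contMDiffOn_id (hβ.comp_contMDiffOn hσ') c1) c3)
      (fun z hz => by rw [G.s_mul _ _ (c3 z hz), G.s_mul _ _ (c1 z hz), hβs])
      (fun z hz => by rw [G.t_mul _ _ (c3 z hz), G.t_inv, hβs])
    have d1 : ∀ z ∈ W, G'.s (γ (τ (G.t z))) = G'.t (ψ.ar (c z)) := fun z hz => by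
      rw [hγs, ψ.t_ar, (hc' z hz).2.1]
    have d2 : ∀ z ∈ W, G'.s (G'.mul (γ (τ (G.t z))) (ψ.ar (c z))) = G'.s (γ (σ (G.s z))) :=
      fun z hz => by rw [G'.s_mul _ _ (d1 z hz), hγs, ψ.s_ar, (hc' z hz).1]
    have d3 : ∀ z ∈ W, G'.s (G'.mul (γ (τ (G.t z))) (ψ.ar (c z))) =
        G'.t (G'.inv (γ (σ (G.s z)))) := fun z hz => by rw [d2 z hz, G'.t_inv]
    refine ⟨W, fun z => G'.mul (G'.mul (γ (τ (G.t z))) (ψ.ar (c z))) (G'.inv (γ (σ (G.s z)))), hW,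
      ⟨hgU, hgV⟩, G'.mul_contMDiffOn (G'.mul_contMDiffOn (hγ.comp_contMDiffOn hτ')
        (ψ.ar_smooth.comp_contMDiffOn hc) d1)
        (G'.inv_smooth.comp_contMDiffOn (hγ.comp_contMDiffOn hσ')) d3, fun z hz => ?_⟩
    refine ⟨σ (G.s z), τ (G.t z), c z, hσw _ hz.1, hτw _ hz.2, (hc' z hz).1, (hc' z hz).2.1,
      ?_, ?_, ?_, ?_⟩
    · rw [(hc' z hz).2.2, G.mul_inv_mul (c2 z hz)]
    · rw [G'.s_mul _ _ (d3 z hz), G'.s_inv, hγt, hσw _ hz.1]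
    · rw [G'.t_mul _ _ (d3 z hz), G'.t_mul _ _ (d1 z hz), hγt, hτw _ hz.2]
    · rw [G'.mul_inv_mul_right (d2 z hz)]
  obtain ⟨F, hF, hFR⟩ := exists_smooth_of_local R huniq hloc
  have hFs : ∀ g, G'.s (F g) = f (G.s g) := fun g => by
    obtain ⟨-, -, -, -, -, -, -, -, h, -, -⟩ := hFR g
    exact h
  have hFt : ∀ g, G'.t (F g) = f (G.t g) := fun g => by
    obtain ⟨-, -, -, -, -, -, -, -, -, h, -⟩ := hFR g
    exact h
  -- Multiplicativity is a pointwise statement, so fullness without smooth dependence suffices.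
  have hex : ∀ g p q, w p = G.s g → w q = G.t g → ∃ h, H.s h = l p ∧ H.t h = l q ∧
      G.mul g (β p) = G.mul (β q) (φ.ar h) := by
    intro g p q hp hq
    have c1 : G.s g = G.t (β p) := by rw [hβt, hp]
    have c2 : G.t (β q) = G.t (G.mul g (β p)) := by rw [hβt, hq, G.t_mul _ _ c1]
    have c3 : G.s (G.inv (β q)) = G.t (G.mul g (β p)) := by rw [G.s_inv, c2]
    obtain ⟨h, h1, h2, h3⟩ := hφ (l p) (l q) (G.mul (G.inv (β q)) (G.mul g (β p)))
      (by rw [G.s_mul _ _ c3, G.s_mul _ _ c1, hβs]) (by rw [G.t_mul _ _ c3, G.t_inv, hβs])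
    exact ⟨h, h1, h2, by rw [h3, G.mul_inv_mul c2]⟩
  have hmul : ∀ g h, G.s g = G.t h → F (G.mul g h) = G'.mul (F g) (F h) := by
    intro g h hgh
    obtain ⟨p, hp⟩ := hsurj (G.s h)
    obtain ⟨q, hq⟩ := hsurj (G.t h)
    obtain ⟨r, hr⟩ := hsurj (G.t g)
    obtain ⟨i, i1, i2, i3⟩ := hex h p q hp hq
    obtain ⟨j, j1, j2, j3⟩ := hex g q r (hq.trans hgh.symm) hr
    have c1 : H.s j = H.t i := by rw [j1, i2]
    have b1 : G.s h = G.t (β p) := by rw [hβt, hp]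
    have b2 : G.s (β q) = G.t (φ.ar i) := by rw [hβs, φ.t_ar, i2]
    have b3 : G.s (β r) = G.t (φ.ar j) := by rw [hβs, φ.t_ar, j2]
    have b4 : G.s (φ.ar j) = G.t (φ.ar i) := by rw [φ.s_ar, φ.t_ar, c1]
    have b5 : G.s g = G.t (β q) := by rw [hβt, hq, hgh]
    have b6 : G'.s (F g) = G'.t (F h) := by rw [hFs, hFt, hgh]
    have d1 : G'.s (F h) = G'.t (γ p) := by rw [hFs, hγt, hp]
    have d2 : G'.s (γ q) = G'.t (ψ.ar i) := by rw [hγs, ψ.t_ar, i2]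
    have d3 : G'.s (γ r) = G'.t (ψ.ar j) := by rw [hγs, ψ.t_ar, j2]
    have d4 : G'.s (ψ.ar j) = G'.t (ψ.ar i) := by rw [ψ.s_ar, ψ.t_ar, c1]
    have d5 : G'.s (F g) = G'.t (γ q) := by rw [hFs, hγt, hq, hgh]
    have kh := key h (F h) (hFR h) p q i hp hq i1 i2 i3
    have kg := key g (F g) (hFR g) q r j (hq.trans hgh.symm) hr j1 j2 j3
    -- The product of the two values satisfies the relation defining `F (G.mul g h)`, witnessed by
    -- the composite arrow of `H`, so uniqueness identifies them.
    refine huniq _ _ _ (hFR _) ⟨p, r, H.mul j i, by rw [hp, G.s_mul _ _ hgh],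
      by rw [hr, G.t_mul _ _ hgh], by rw [H.s_mul _ _ c1, i1], by rw [H.t_mul _ _ c1, j2],
      ?_, by rw [G'.s_mul _ _ b6, hFs, G.s_mul _ _ hgh],
      by rw [G'.t_mul _ _ b6, hFt, G.t_mul _ _ hgh], ?_⟩
    · rw [φ.ar_mul _ _ c1, ← G.mul_assoc _ _ _ b3 b4, ← j3, G.mul_assoc _ _ _ b5 b2, ← i3,
        G.mul_assoc _ _ _ hgh b1]
    · rw [ψ.ar_mul _ _ c1, ← G'.mul_assoc _ _ _ d3 d4, ← kg, G'.mul_assoc _ _ _ d5 d2, ← kh,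
        G'.mul_assoc _ _ _ b6 d1]
  let θ : Hom G G' := ⟨f, F, hf, hF, hFs, hFt, hmul⟩
  refine ⟨θ, rfl, ?_⟩
  -- The isomorphism `ψ ≅ θφ` at `x` is `γ(p) ψ(j)⁻¹`, where `p` lies over `φ(x)` and `j : l(p) → x`
  -- is the lift of `β(p)`.
  let D : H.Ob → G'.Ar → Prop := fun x d => ∃ p j, w p = φ.ob x ∧ H.s j = l p ∧ H.t j = x ∧
    φ.ar j = β p ∧ G'.s d = ψ.ob x ∧ G'.t d = f (φ.ob x) ∧ G'.mul d (ψ.ar j) = γ p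
  have nat : ∀ h d d', D (H.s h) d → D (H.t h) d' →
      G'.mul d' (ψ.ar h) = G'.mul (F (φ.ar h)) d := by
    rintro h d d' ⟨p, i, hp, i1, i2, i3, hds, hdt, hd⟩ ⟨q, j, hq, j1, j2, j3, hds', hdt', hd'⟩
    have c1 : H.s h = H.t i := i2.symm
    have c2 : H.t j = H.t (H.mul h i) := by rw [j2, H.t_mul _ _ c1]
    have c3 : H.s (H.inv j) = H.t (H.mul h i) := by rw [H.s_inv, c2]
    let k := H.mul (H.inv j) (H.mul h i)
    have hk : H.mul j k = H.mul h i := H.mul_inv_mul c2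
    have hk1 : H.s k = l p := by rw [H.s_mul _ _ c3, H.s_mul _ _ c1, i1]
    have hk2 : H.t k = l q := by rw [H.t_mul _ _ c3, H.t_inv, j1]
    have c4 : H.s j = H.t k := by rw [hk2, j1]
    have e := key (φ.ar h) _ (hFR _) p q k (by rw [hp, φ.s_ar]) (by rw [hq, φ.t_ar]) hk1 hk2
      (by rw [← i3, ← j3, ← φ.ar_mul _ _ c1, ← φ.ar_mul _ _ c4, hk])
    have b1 : G'.s d' = G'.t (ψ.ar h) := by rw [hds', ψ.t_ar]
    have b2 : G'.s (ψ.ar h) = G'.t (ψ.ar i) := by rw [ψ.s_ar, ψ.t_ar, c1]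
    have b3 : G'.s d' = G'.t (ψ.ar j) := by rw [hds', ψ.t_ar, j2]
    have b4 : G'.s (ψ.ar j) = G'.t (ψ.ar k) := by rw [ψ.s_ar, ψ.t_ar, c4]
    have b5 : G'.s (F (φ.ar h)) = G'.t d := by rw [hFs, hdt, φ.s_ar]
    have b6 : G'.s d = G'.t (ψ.ar i) := by rw [hds, ψ.t_ar, i2]
    refine G'.mul_right_cancel (c := ψ.ar i) (by rw [G'.s_mul _ _ b1, b2])
      (by rw [G'.s_mul _ _ b5, b6]) ?_
    rw [G'.mul_assoc _ _ _ b1 b2, ← ψ.ar_mul _ _ c1, ← hk, ψ.ar_mul _ _ c4,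
      ← G'.mul_assoc _ _ _ b3 b4, hd', ← e, G'.mul_assoc _ _ _ b5 b6, hd]
  have Duniq : ∀ x d d', D x d → D x d' → d = d' := by
    intro x d d' hd hd'
    have n := nat (H.unit x) d d' (by rwa [H.s_unit]) (by rwa [H.t_unit])
    have e := θ.ar_unit (φ.ob x)
    obtain ⟨-, -, -, -, -, -, e1, e2, -⟩ := hd
    obtain ⟨-, -, -, -, -, -, e3, e4, -⟩ := hd'
    change F _ = G'.unit (f _) at e
    rw [ψ.ar_unit, φ.ar_unit, e, ← e3, ← e2, G'.mul_unit, G'.unit_mul] at n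
    exact n.symm
  have Dloc : ∀ x, ∃ (U : Set H.Ob) (σ : H.Ob → G'.Ar), IsOpen U ∧ x ∈ U ∧
      ContMDiffOn (𝓡 H.Ob.dim) (𝓡 G'.Ar.dim) ∞ σ U ∧ ∀ z ∈ U, D z (σ z) := by
    intro x
    obtain ⟨U, σ, hU, hxU, hσ, hσw⟩ := hsec (φ.ob x)
    let W : Set H.Ob := φ.ob ⁻¹' U
    have hW : IsOpen W := hU.preimage φ.ob_smooth.continuous
    have hσ' : ContMDiffOn (𝓡 H.Ob.dim) (𝓡 C.dim) ∞ (fun z => σ (φ.ob z)) W :=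
      hσ.comp φ.ob_smooth.contMDiffOn fun z hz => hz
    obtain ⟨c, hc, hc'⟩ := hlift H.Ob W (fun z => l (σ (φ.ob z))) (fun z => z)
      (fun z => β (σ (φ.ob z))) hW (hl.comp_contMDiffOn hσ') contMDiffOn_id
      (hβ.comp_contMDiffOn hσ') (fun z hz => hβs _) (fun z hz => by rw [hβt, hσw _ hz])
    have d1 : ∀ z ∈ W, G'.s (γ (σ (φ.ob z))) = G'.s (ψ.ar (c z)) := fun z hz => by
      rw [hγs, ψ.s_ar, (hc' z hz).1]
    have d2 : ∀ z ∈ W, G'.s (γ (σ (φ.ob z))) = G'.t (G'.inv (ψ.ar (c z))) := fun z hz => by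
      rw [d1 z hz, G'.t_inv]
    refine ⟨W, fun z => G'.mul (γ (σ (φ.ob z))) (G'.inv (ψ.ar (c z))), hW, hxU,
      G'.mul_contMDiffOn (hγ.comp_contMDiffOn hσ')
        (G'.inv_smooth.comp_contMDiffOn (ψ.ar_smooth.comp_contMDiffOn hc)) d2, fun z hz => ?_⟩
    refine ⟨σ (φ.ob z), c z, hσw _ hz, (hc' z hz).1, (hc' z hz).2.1, (hc' z hz).2.2, ?_, ?_, ?_⟩
    · rw [G'.s_mul _ _ (d2 z hz), G'.s_inv, ψ.t_ar, (hc' z hz).2.1]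
    · rw [G'.t_mul _ _ (d2 z hz), hγt, hσw _ hz]
    · rw [G'.mul_inv_mul_right (d1 z hz)]
  obtain ⟨δ, hδ, hδD⟩ := exists_smooth_of_local D Duniq Dloc
  refine ⟨δ, hδ, fun x => ?_, fun x => ?_, fun h => nat h _ _ (hδD _) (hδD _)⟩
  · obtain ⟨-, -, -, -, -, -, h, -, -⟩ := hδD x
    exact h
  · obtain ⟨-, -, -, -, -, -, -, h, -⟩ := hδD x
    exact h

/-- Every commutative square is induced by a map of Lie groupoids. -/
lemma Hom.square_surjective (G G' : LieGroupoid.{u}) :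
    Function.Surjective (Hom.square : Hom G G' → CommSquare G G') := by
  intro S
  obtain ⟨a, K, w, l, ha, hw, ⟨β, hβ⟩, ⟨γ, hγ⟩⟩ := S.exists_cover
  obtain ⟨θ, hθ, hiso⟩ := exists_hom_of_cover (C := K.Ob) (φ := a.φ) (ψ := a.ψ) (w := w.ob)
    (l := l.ob) (f := S.f) (β := β) (γ := γ) a.weq.fullyFaithful.isFull
    a.weq.fullyFaithful.isFaithful a.weq.fullyFaithful.liftsArrows l.ob_smooth S.f_smooth hβ.smooth
    hγ.smooth hβ.s_eq hβ.t_eq hγ.s_eq hγ.t_eq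
    (fun x => by
      obtain ⟨U, σ, τ, hU, hx, hσ, -, hs⟩ := hw.essentiallySurjective.hasLocalSections x
      exact ⟨U, σ, hU, hx, hσ, fun z hz => (hs z hz).1.symm.trans (hs z hz).2⟩)
    (fun p q hpq => exists_cover_transition hw.fullyFaithful.isFull hβ hγ hpq)
  refine ⟨θ, CommSquare.ext hθ ?_⟩
  rw [← ha]
  exact ((Fraction.toGenMap_eq_iff θ a).2 hiso).symm

lemma Isomorphic.presentation_comp {G G' : LieGroupoid.{u}} {θ₁ θ₂ : Hom G G'}
    (h : Isomorphic θ₁ θ₂) :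
    Isomorphic (G'.presentation.comp (homOfSmooth θ₁.ob θ₁.ob_smooth))
      (G'.presentation.comp (homOfSmooth θ₂.ob θ₂.ob_smooth)) := by
  obtain ⟨α, hs, h1, h2, -⟩ := h
  have h3 : ∀ x, G'.mul (α x) (G'.unit (θ₁.ob x)) = G'.mul (G'.unit (θ₂.ob x)) (α x) :=
    fun x => by rw [← h1, ← h2, G'.mul_unit, G'.unit_mul]
  exact ⟨α, hs, h1, h2, h3⟩

end LieGroupoid

/-! ### The two bijections -/

theorem mainTheorem6 (G G' : LieGroupoid.{u}) :
    (∃ Φ : Quotient (LieGroupoid.isoSetoid G G') ≃ Quotient (LieGroupoid.squareSetoid G G'),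
      ∀ θ : LieGroupoid.Hom G G', Φ (Quotient.mk _ θ) = Quotient.mk _ θ.square) ∧
    (∃ Ψ : Quotient (LieGroupoid.isoOverBaseSetoid G G') ≃ LieGroupoid.CommSquare G G',
      ∀ θ : LieGroupoid.Hom G G', Ψ (Quotient.mk _ θ) = θ.square) := by
  constructor
  · let Φ : Quotient (LieGroupoid.isoSetoid G G') → Quotient (LieGroupoid.squareSetoid G G') :=
      Quotient.map LieGroupoid.Hom.square fun θ₁ θ₂ h =>
        ⟨(LieGroupoid.Hom.toGenMap_eq_iff θ₁ θ₂).2 h, LieGroupoid.Isomorphic.presentation_comp h⟩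
    refine ⟨Equiv.ofBijective Φ ⟨?_, ?_⟩, fun θ => rfl⟩
    · rintro ⟨θ₁⟩ ⟨θ₂⟩ h
      -- Equality of the generalized maps alone already gives an isomorphism; the object part of the
      -- square isomorphism adds nothing.
      exact Quotient.sound ((LieGroupoid.Hom.toGenMap_eq_iff θ₁ θ₂).1 (Quotient.exact h).1)
    · rintro ⟨S⟩
      obtain ⟨θ, rfl⟩ := LieGroupoid.Hom.square_surjective G G' S
      exact ⟨Quotient.mk _ θ, rfl⟩
  · let Ψ : Quotient (LieGroupoid.isoOverBaseSetoid G G') → LieGroupoid.CommSquare G G' :=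
      Quotient.lift LieGroupoid.Hom.square fun θ₁ θ₂ h =>
        LieGroupoid.CommSquare.ext h.1 ((LieGroupoid.Hom.toGenMap_eq_iff θ₁ θ₂).2 h.2)
    refine ⟨Equiv.ofBijective Ψ ⟨?_, ?_⟩, fun θ => rfl⟩
    · rintro ⟨θ₁⟩ ⟨θ₂⟩ h
      exact Quotient.sound ⟨congrArg LieGroupoid.CommSquare.f h,
        (LieGroupoid.Hom.toGenMap_eq_iff θ₁ θ₂).1 (congrArg LieGroupoid.CommSquare.F h)⟩
    · intro S
      obtain ⟨θ, rfl⟩ := LieGroupoid.Hom.square_surjective G G' S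
      exact ⟨Quotient.mk _ θ, rfl⟩
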